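/- For a compact set $\Gamma\subset\mathbb{R}^2$ and a point $x\in\mathbb{R}^2$, let $$\Gamma_x=\{u\in\Gamma : [x,u]\cap\Gamma=\{u\}\}$$ be the part of $\Gamma$ visible from $x$, where $[x,u]$ denotes the closed line segment joining $x$ to $u$, and let $\dim_H$ denote Hausdorff dimension. Let $\Gamma\subset\mathbb{R}^2$ be a compact connected set with $\dim_H\Gamma>1$. Then for every real number $s$ with $$\tfrac12+\sqrt{\dim_H\Gamma-\tfrac34}<s\le\dim_H\Gamma,$$ we have $$\dim_H\{x\in\mathbb{R}^2 : \dim_H(\Gamma_x)>s\}\le\frac{\dim_H\Gamma-s}{s-1}.$$ -/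

import Mathlib

/-- The part of `K` visible from `x`: the points `u` of `K` such that the closed segment
joining `x` to `u` meets `K` only at `u`. -/
def visiblePart (K : Set (EuclideanSpace ℝ (Fin 2))) (x : EuclideanSpace ℝ (Fin 2)) :
    Set (EuclideanSpace ℝ (Fin 2)) :=
  {u | u ∈ K ∧ segment ℝ x u ∩ K = {u}}

/-! Write d for the dimension of Γ and δ = 2⁻ᵏ. The parts of Γ visible from two points x and y
overlap little: up to powers of k they share at most δ⁻¹ / |x - y| dyadic squares of side δ
(`card_common_le`). To see this, describe a point off the line xy by the directions in which x and y
see it, so that lines through x become columns and lines through y become rows. The segment from x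
to a visible point is a stretch of column which Γ meets only at its end; segments from y do the same
in rows. If two such columns and two such rows reach past the box they bound, Γ misses the boundary
of the box, and being connected with points outside, it has none inside (`not_mem_walled_box`). The
cells occupied by common squares thus avoid a fixed pattern in an n × n grid, so there are O(n log
n) of them instead of n² (`card_le_of_avoids_walls`).

The rest is a second moment argument. Suppose the exceptional set had dimension above some t ≤ 1
with t(s - 1) > d - s. A discrete Frostman lemma gives, at some scale, about δ^(-t(s-1)) viewpoints,
spread t-dimensionally down to separation δ^(s-1), each seeing M ≈ δ^(-s) of at most about δ^(-d)
squares from a cover of Γ. As t ≤ 1, summing 1 / |x - y| over them costs, up to logarithms, only the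
inverse of the finest separation, so the common squares of one viewpoint with all others number at
most about M + δ⁻¹ δ^(-(s-1)) ≈ δ^(-s). The separation δ^(s-1) is chosen to balance these two terms.
Cauchy–Schwarz (`card_mul_sq_le`) then yields δ^(-t(s-1)) δ^(-2s) ≲ δ^(-d) δ^(-s), contradicting the
choice of t. The lower bound on s is used to ensure s > 1 and (d - s)/(s - 1) < 1, which leaves room
for such a t. -/

/-! ### Lattice sets avoiding a walled box -/

/-- A finite set carrying a function with values in `(0, 2 ^ L)`, any two of whose values differ
at least by a factor two, has at most `L` elements. -/
lemma card_le_of_doubling {α : Type*} (S : Finset α) (f : α → ℤ) (L : ℕ)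
    (hpos : ∀ a ∈ S, 0 < f a) (hlt : ∀ a ∈ S, f a < 2 ^ L)
    (hdouble : ∀ a ∈ S, ∀ b ∈ S, a ≠ b → 2 * f a ≤ f b ∨ 2 * f b ≤ f a) : S.card ≤ L := by
  -- Doubling the value raises its integer binary logarithm, so this logarithm is injective on `S`,
  -- with values below `L`.
  have hlog : ∀ p q : ℤ, 0 < p → 2 * p ≤ q → Nat.log 2 p.toNat < Nat.log 2 q.toNat := by
    intro p q hp hpq
    have h1 : Nat.log 2 (p.toNat * 2) = Nat.log 2 p.toNat + 1 :=
      Nat.log_mul_base (by norm_num) (by omega)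
    have h2 : Nat.log 2 (p.toNat * 2) ≤ Nat.log 2 q.toNat := Nat.log_mono_right (by omega)
    omega
  rw [← Finset.card_range L]
  refine Finset.card_le_card_of_injOn (fun a => Nat.log 2 (f a).toNat) ?_ ?_
  · intro a ha
    have h1 := hpos a ha
    have h2 := hlt a ha
    simp only [Finset.coe_range, Set.mem_Iio]
    refine Nat.log_lt_of_lt_pow (by omega) ?_
    zify
    rw [Int.toNat_of_nonneg h1.le]
    exact h2
  · intro a ha b hb hab
    by_contra hne
    simp only at hab
    rcases hdouble a ha b hb hne with h | h
    · have := hlog _ _ (hpos a ha) h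
      omega
    · have := hlog _ _ (hpos b hb) h
      omega

/-- A finite set of lattice points containing no four points `(i₃, j₃)`, `(i₁, j₃)`, `(i₃, j₁)`,
`(i₂, j₂)` with `i₁ < i₂ < i₃` and `j₁ < j₂ < j₃` has `O(n log n)` elements. -/
lemma card_le_of_avoids_corner (G : Finset (ℤ × ℤ)) (n L : ℕ)
    (hcol : (G.image Prod.fst).card ≤ n) (hrow : (G.image Prod.snd).card ≤ n)
    (hrange : ∀ a ∈ G, ∀ b ∈ G, a.2 - b.2 < 2 ^ L)
    (havoid : ∀ i₁ i₂ i₃ j₁ j₂ j₃ : ℤ, i₁ < i₂ → i₂ < i₃ → j₁ < j₂ → j₂ < j₃ →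
      (i₃, j₃) ∈ G → (i₁, j₃) ∈ G → (i₃, j₁) ∈ G → (i₂, j₂) ∈ G → False) :
    G.card ≤ n * (2 + 2 * L) := by
  classical
  have hB : ∀ a ∈ G, ∃ B : ℤ, (a.1, B) ∈ G ∧ ∀ b ∈ G, b.1 = a.1 → B ≤ b.2 := by
    intro a ha
    obtain ⟨c, hc, hmin⟩ := (G.filter fun b => b.1 = a.1).exists_min_image Prod.snd
      ⟨a, by simp [ha]⟩
    rw [Finset.mem_filter] at hc
    refine ⟨c.2, ?_, fun b hb hba => hmin b (by simp [hb, hba])⟩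
    rw [← hc.2]
    exact hc.1
  have hp : ∀ a ∈ G, (∃ b ∈ G, b.1 = a.1 ∧ b.2 < a.2) →
      ∃ p : ℤ, (a.1, p) ∈ G ∧ p < a.2 ∧ ∀ b ∈ G, b.1 = a.1 → b.2 < a.2 → b.2 ≤ p := by
    rintro a ha ⟨b, hb, hba, hlt⟩
    obtain ⟨c, hc, hmax⟩ := (G.filter fun b => b.1 = a.1 ∧ b.2 < a.2).exists_max_image Prod.snd
      ⟨b, by simp [hb, hba, hlt]⟩
    rw [Finset.mem_filter] at hc
    refine ⟨c.2, ?_, hc.2.2, fun b hb hba hlt => hmax b (by simp [hb, hba, hlt])⟩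
    rw [← hc.2.1]
    exact hc.1
  -- `B a` is the height of the lowest point in the column of `a`; `p a` is the height of the next
  -- point below `a`.
  choose! B hBmem hBmin using hB
  choose! p hpmem hplt hpmax using hp
  set left := G.filter fun a => ∀ b ∈ G, b.2 = a.2 → a.1 ≤ b.1 with hleft
  set bot := G.filter fun a => ∀ b ∈ G, b.1 = a.1 → a.2 ≤ b.2 with hbot
  set rest := G.filter fun a => (∃ b ∈ G, b.2 = a.2 ∧ b.1 < a.1) ∧
    ∃ b ∈ G, b.1 = a.1 ∧ b.2 < a.2 with hrest
  -- The gap below `a` is compared with half the height of `a` over its column's bottom. Going up a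
  -- column, that height at least doubles between long points; going right along a row, the gap at
  -- least halves between short points. Either way a line holds at most `L` of them.
  set long := rest.filter fun a => a.2 - B a < 2 * (a.2 - p a) with hlong
  set short := rest.filter fun a => 2 * (a.2 - p a) ≤ a.2 - B a with hshort
  have hcover : G ⊆ (left ∪ bot) ∪ (long ∪ short) := by
    intro a ha
    simp only [hleft, hbot, hlong, hshort, hrest, Finset.mem_union, Finset.mem_filter]
    by_cases h1 : ∀ b ∈ G, b.2 = a.2 → a.1 ≤ b.1
    · exact Or.inl (Or.inl ⟨ha, h1⟩)
    by_cases h2 : ∀ b ∈ G, b.1 = a.1 → a.2 ≤ b.2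
    · exact Or.inl (Or.inr ⟨ha, h2⟩)
    push Not at h1 h2
    rcases lt_or_ge (a.2 - B a) (2 * (a.2 - p a)) with h | h
    · exact Or.inr (Or.inl ⟨⟨ha, h1, h2⟩, h⟩)
    · exact Or.inr (Or.inr ⟨⟨ha, h1, h2⟩, h⟩)
  have hleft_card : left.card ≤ n := by
    refine le_trans ?_ hrow
    refine Finset.card_le_card_of_injOn Prod.snd ?_ ?_
    · intro a ha
      have ha' := (Finset.mem_filter.1 (Finset.mem_coe.1 ha)).1
      exact Finset.mem_coe.2 (Finset.mem_image_of_mem _ ha')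
    · intro a ha b hb hab
      have ha' := Finset.mem_filter.1 (Finset.mem_coe.1 ha)
      have hb' := Finset.mem_filter.1 (Finset.mem_coe.1 hb)
      exact Prod.ext (le_antisymm (ha'.2 b hb'.1 hab.symm) (hb'.2 a ha'.1 hab)) hab
  have hbot_card : bot.card ≤ n := by
    refine le_trans ?_ hcol
    refine Finset.card_le_card_of_injOn Prod.fst ?_ ?_
    · intro a ha
      have ha' := (Finset.mem_filter.1 (Finset.mem_coe.1 ha)).1
      exact Finset.mem_coe.2 (Finset.mem_image_of_mem _ ha')
    · intro a ha b hb hab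
      have ha' := Finset.mem_filter.1 (Finset.mem_coe.1 ha)
      have hb' := Finset.mem_filter.1 (Finset.mem_coe.1 hb)
      exact Prod.ext hab (le_antisymm (ha'.2 b hb'.1 hab.symm) (hb'.2 a ha'.1 hab))
  have hlong_card : long.card ≤ L * n := by
    refine le_trans (Finset.card_le_mul_card_image (f := Prod.fst) long L ?_) ?_
    · intro i _
      refine card_le_of_doubling _ (fun a => a.2 - B a) L ?_ ?_ ?_
      · intro a ha
        simp only [hlong, hrest, Finset.mem_filter] at ha
        obtain ⟨⟨⟨haG, -, b, hb, hba, hlt⟩, -⟩, -⟩ := ha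
        have := hBmin a haG b hb hba
        omega
      · intro a ha
        simp only [hlong, hrest, Finset.mem_filter] at ha
        exact hrange a ha.1.1.1 _ (hBmem a ha.1.1.1)
      · have key : ∀ a ∈ long, ∀ b ∈ long, a.1 = b.1 → a.2 < b.2 →
            2 * (a.2 - B a) ≤ b.2 - B b := by
          intro a ha b hb hab hlt
          simp only [hlong, hrest, Finset.mem_filter] at ha hb
          obtain ⟨⟨haG, -, -⟩, -⟩ := ha
          obtain ⟨⟨hbG, -, hb2⟩, hb3⟩ := hb
          have h1 := hpmax b hbG hb2 a haG hab hlt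
          have h2 := hBmin a haG _ (hBmem b hbG) hab.symm
          have h3 := hBmin b hbG _ (hBmem a haG) hab
          simp only at h2 h3
          omega
        intro a ha b hb hne
        rw [Finset.mem_filter] at ha hb
        have hab : a.1 = b.1 := by rw [ha.2, hb.2]
        rcases lt_trichotomy a.2 b.2 with h | h | h
        · exact Or.inl (key a ha.1 b hb.1 hab h)
        · exact absurd (Prod.ext hab h) hne
        · exact Or.inr (key b hb.1 a ha.1 hab.symm h)
    · refine Nat.mul_le_mul_left _ (le_trans (Finset.card_le_card ?_) hcol)
      exact Finset.image_subset_image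
        ((Finset.filter_subset _ _).trans (Finset.filter_subset _ _))
  have hshort_card : short.card ≤ L * n := by
    refine le_trans (Finset.card_le_mul_card_image (f := Prod.snd) short L ?_) ?_
    · intro j _
      refine card_le_of_doubling _ (fun a => a.2 - p a) L ?_ ?_ ?_
      · intro a ha
        simp only [hshort, hrest, Finset.mem_filter] at ha
        have := hplt a ha.1.1.1 ha.1.1.2.2
        omega
      · intro a ha
        simp only [hshort, hrest, Finset.mem_filter] at ha
        exact hrange a ha.1.1.1 _ (hpmem a ha.1.1.1 ha.1.1.2.2)
      · have key : ∀ a ∈ short, ∀ b ∈ short, a.2 = b.2 → a.1 < b.1 →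
            2 * (b.2 - p b) ≤ a.2 - p a := by
          intro a ha b hb hab hlt
          simp only [hshort, hrest, Finset.mem_filter] at ha hb
          obtain ⟨⟨haG, ⟨c, hc, hca, hclt⟩, ha2⟩, -⟩ := ha
          obtain ⟨⟨hbG, -, hb2⟩, hb3⟩ := hb
          -- Otherwise `b`, `c`, the bottom of the column of `b` and the predecessor of `a` form the
          -- forbidden pattern. Hence the gap of `a` is at least the height of `b` over its column's
          -- bottom, which is at least twice the gap of `b`.
          have hpB : p a ≤ B b := by
            by_contra hcon
            push Not at hcon
            have e1 : (b.1, b.2) ∈ G := hbG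
            have e2 : (c.1, b.2) ∈ G := by rw [← hab, ← hca]; exact hc
            have h1 := hplt a haG ha2
            exact havoid c.1 a.1 b.1 (B b) (p a) b.2 hclt hlt hcon (by omega) e1 e2
              (hBmem b hbG) (hpmem a haG ha2)
          omega
        intro a ha b hb hne
        rw [Finset.mem_filter] at ha hb
        have hab : a.2 = b.2 := by rw [ha.2, hb.2]
        rcases lt_trichotomy a.1 b.1 with h | h | h
        · exact Or.inr (key a ha.1 b hb.1 hab h)
        · exact absurd (Prod.ext h hab) hne
        · exact Or.inl (key b hb.1 a ha.1 hab.symm h)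
    · refine Nat.mul_le_mul_left _ (le_trans (Finset.card_le_card ?_) hrow)
      exact Finset.image_subset_image
        ((Finset.filter_subset _ _).trans (Finset.filter_subset _ _))
  have h1 := Finset.card_le_card hcover
  have h2 := Finset.card_union_le (left ∪ bot) (long ∪ short)
  have h3 := Finset.card_union_le left bot
  have h4 := Finset.card_union_le long short
  nlinarith

/-- A finite set of lattice points such that no box is walled in by two columns and two rows of
the set reaching past the box, and contains a further point of the set, has `O(n log n)` elements. -/
lemma card_le_of_avoids_walls (G : Finset (ℤ × ℤ)) (n L : ℕ)
    (hcol : (G.image Prod.fst).card ≤ n) (hrow : (G.image Prod.snd).card ≤ n)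
    (hrange : ∀ a ∈ G, ∀ b ∈ G, a.2 - b.2 < 2 ^ L)
    (havoid : ∀ i₁ i₂ i₃ j₁ j₂ j₃ a b c d : ℤ, i₁ < i₂ → i₂ < i₃ → j₁ < j₂ → j₂ < j₃ →
      j₃ < a → j₃ < b → i₃ < c → i₃ < d →
      (i₁, a) ∈ G → (i₃, b) ∈ G → (i₂, j₂) ∈ G → (c, j₁) ∈ G → (d, j₃) ∈ G → False) :
    G.card ≤ n * (4 + 2 * L) := by
  classical
  set right := G.filter fun a => ∀ b ∈ G, b.2 = a.2 → b.1 ≤ a.1 with hright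
  set top := G.filter fun a => ∀ b ∈ G, b.1 = a.1 → b.2 ≤ a.2 with htop
  -- In a corner pattern of points that have a further point to the right and another above, these
  -- further points extend the four walls past the box.
  set rest := G.filter fun a => (∃ b ∈ G, b.2 = a.2 ∧ a.1 < b.1) ∧
    ∃ b ∈ G, b.1 = a.1 ∧ a.2 < b.2 with hrest
  have hcover : G ⊆ (right ∪ top) ∪ rest := by
    intro a ha
    simp only [hright, htop, hrest, Finset.mem_union, Finset.mem_filter]
    by_cases h1 : ∀ b ∈ G, b.2 = a.2 → b.1 ≤ a.1
    · exact Or.inl (Or.inl ⟨ha, h1⟩)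
    by_cases h2 : ∀ b ∈ G, b.1 = a.1 → b.2 ≤ a.2
    · exact Or.inl (Or.inr ⟨ha, h2⟩)
    push Not at h1 h2
    exact Or.inr ⟨ha, h1, h2⟩
  have hright_card : right.card ≤ n := by
    refine le_trans ?_ hrow
    refine Finset.card_le_card_of_injOn Prod.snd ?_ ?_
    · intro a ha
      have ha' := (Finset.mem_filter.1 (Finset.mem_coe.1 ha)).1
      exact Finset.mem_coe.2 (Finset.mem_image_of_mem _ ha')
    · intro a ha b hb hab
      have ha' := Finset.mem_filter.1 (Finset.mem_coe.1 ha)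
      have hb' := Finset.mem_filter.1 (Finset.mem_coe.1 hb)
      exact Prod.ext (le_antisymm (hb'.2 a ha'.1 hab) (ha'.2 b hb'.1 hab.symm)) hab
  have htop_card : top.card ≤ n := by
    refine le_trans ?_ hcol
    refine Finset.card_le_card_of_injOn Prod.fst ?_ ?_
    · intro a ha
      have ha' := (Finset.mem_filter.1 (Finset.mem_coe.1 ha)).1
      exact Finset.mem_coe.2 (Finset.mem_image_of_mem _ ha')
    · intro a ha b hb hab
      have ha' := Finset.mem_filter.1 (Finset.mem_coe.1 ha)
      have hb' := Finset.mem_filter.1 (Finset.mem_coe.1 hb)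
      exact Prod.ext hab (le_antisymm (hb'.2 a ha'.1 hab) (ha'.2 b hb'.1 hab.symm))
  have hrestG : rest ⊆ G := Finset.filter_subset _ _
  have hrest_card : rest.card ≤ n * (2 + 2 * L) := by
    refine card_le_of_avoids_corner rest n L
      ((Finset.card_le_card (Finset.image_subset_image hrestG)).trans hcol)
      ((Finset.card_le_card (Finset.image_subset_image hrestG)).trans hrow)
      (fun a ha b hb => hrange a (hrestG ha) b (hrestG hb)) ?_
    intro i₁ i₂ i₃ j₁ j₂ j₃ hi hi' hj hj' h33 h13 h31 h22
    obtain ⟨-, ⟨⟨d, _⟩, hd, rfl, hdlt⟩, ⟨⟨_, b⟩, hb, rfl, hblt⟩⟩ := Finset.mem_filter.1 h33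
    obtain ⟨-, -, ⟨⟨_, a⟩, ha, rfl, halt⟩⟩ := Finset.mem_filter.1 h13
    obtain ⟨-, ⟨⟨c, _⟩, hc, rfl, hclt⟩, -⟩ := Finset.mem_filter.1 h31
    exact havoid _ _ _ _ _ _ a b c d hi hi' hj hj' halt hblt hclt hdlt ha hb (hrestG h22) hc hd
  have h1 := Finset.card_le_card hcover
  have h2 := Finset.card_union_le (right ∪ top) rest
  have h3 := Finset.card_union_le right top
  nlinarith

/-- The version of `card_le_of_avoids_walls` in which the forbidden configurations are only those
whose coordinates are separated by gaps of at least two. -/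
lemma card_le_of_avoids_separated_walls (G : Finset (ℤ × ℤ)) (n L : ℕ)
    (hcol : (G.image Prod.fst).card ≤ n) (hrow : (G.image Prod.snd).card ≤ n)
    (hrange : ∀ a ∈ G, ∀ b ∈ G, a.2 - b.2 < 2 ^ L)
    (havoid : ∀ i₁ i₂ i₃ j₁ j₂ j₃ a b c d : ℤ, i₁ + 2 ≤ i₂ → i₂ + 2 ≤ i₃ → j₁ + 2 ≤ j₂ →
      j₂ + 2 ≤ j₃ → j₃ + 2 ≤ a → j₃ + 2 ≤ b → i₃ + 2 ≤ c → i₃ + 2 ≤ d →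
      (i₁, a) ∈ G → (i₃, b) ∈ G → (i₂, j₂) ∈ G → (c, j₁) ∈ G → (d, j₃) ∈ G → False) :
    G.card ≤ 4 * (n * (4 + 2 * L)) := by
  classical
  -- Within one of the four parity classes, distinct coordinates differ by at least two, so strict
  -- inequalities become the required gaps.
  have hclass : ∀ e ∈ G.image (fun a : ℤ × ℤ => (decide (a.1 % 2 = 0), decide (a.2 % 2 = 0))),
      (G.filter fun a => (decide (a.1 % 2 = 0), decide (a.2 % 2 = 0)) = e).card ≤
        n * (4 + 2 * L) := by
    intro e _
    set G' := G.filter fun a => (decide (a.1 % 2 = 0), decide (a.2 % 2 = 0)) = e with hG'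
    have hsub : G' ⊆ G := Finset.filter_subset _ _
    have hpar : ∀ a ∈ G', ∀ b ∈ G', (a.1 % 2 = 0 ↔ b.1 % 2 = 0) ∧ (a.2 % 2 = 0 ↔ b.2 % 2 = 0) := by
      intro a ha b hb
      have h : (decide (a.1 % 2 = 0), decide (a.2 % 2 = 0)) =
          (decide (b.1 % 2 = 0), decide (b.2 % 2 = 0)) := by
        rw [(Finset.mem_filter.1 ha).2, (Finset.mem_filter.1 hb).2]
      simpa using h
    refine card_le_of_avoids_walls G' n L
      ((Finset.card_le_card (Finset.image_subset_image hsub)).trans hcol)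
      ((Finset.card_le_card (Finset.image_subset_image hsub)).trans hrow)
      (fun a ha b hb => hrange a (hsub ha) b (hsub hb)) ?_
    intro i₁ i₂ i₃ j₁ j₂ j₃ a b c d h1 h2 h3 h4 h5 h6 h7 h8 m1 m2 m3 m4 m5
    have p1 := hpar _ m1 _ m2
    have p2 := hpar _ m1 _ m3
    have p3 := hpar _ m1 _ m4
    have p4 := hpar _ m1 _ m5
    simp only at p1 p2 p3 p4
    exact havoid i₁ i₂ i₃ j₁ j₂ j₃ a b c d (by omega) (by omega) (by omega) (by omega) (by omega)
      (by omega) (by omega) (by omega) (hsub m1) (hsub m2) (hsub m3) (hsub m4) (hsub m5)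
  refine le_trans (Finset.card_le_mul_card_image (f := fun a : ℤ × ℤ =>
    (decide (a.1 % 2 = 0), decide (a.2 % 2 = 0))) G _ hclass) ?_
  rw [mul_comm]
  refine Nat.mul_le_mul_right _ ?_
  refine (Finset.card_le_univ _).trans ?_
  simp

/-! ### Coordinates adapted to two viewpoints -/

/-- The Euclidean plane. -/
abbrev Plane : Type := EuclideanSpace ℝ (Fin 2)

lemma plane_dist_sq (w w' : Plane) :
    dist w w' ^ 2 = (w 0 - w' 0) ^ 2 + (w 1 - w' 1) ^ 2 := by
  rw [EuclideanSpace.dist_eq, Real.sq_sqrt (Finset.sum_nonneg fun _ _ => sq_nonneg _),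
    Fin.sum_univ_two, Real.dist_eq, Real.dist_eq, sq_abs, sq_abs]

lemma plane_abs_sub_le_dist (w w' : Plane) (i : Fin 2) : |w i - w' i| ≤ dist w w' := by
  refine abs_le_of_sq_le_sq ?_ dist_nonneg
  rw [plane_dist_sq]
  fin_cases i
  · exact le_add_of_nonneg_right (sq_nonneg _)
  · exact le_add_of_nonneg_left (sq_nonneg _)

/-- The coordinate of `w` along the line from `x` to `y`, with origin `x`. -/
noncomputable def along (x y w : Plane) : ℝ :=
  ((y 0 - x 0) * (w 0 - x 0) + (y 1 - x 1) * (w 1 - x 1)) / dist x y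

/-- The signed distance of `w` from the line through `x` and `y`. -/
noncomputable def height (x y w : Plane) : ℝ :=
  ((y 0 - x 0) * (w 1 - x 1) - (y 1 - x 1) * (w 0 - x 0)) / dist x y

@[simp] lemma along_left (x y : Plane) : along x y x = 0 := by simp [along]

@[simp] lemma height_left (x y : Plane) : height x y x = 0 := by simp [height]

@[simp] lemma height_right (x y : Plane) : height x y y = 0 := by
  rw [height, mul_comm, sub_self, zero_div]

lemma along_right {x y : Plane} (hxy : x ≠ y) : along x y y = dist x y := by
  have h := dist_pos.2 hxy
  have h2 := plane_dist_sq y x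
  rw [dist_comm] at h2
  rw [along, div_eq_iff h.ne', ← sq (dist x y), h2]
  ring

lemma height_swap (x y w : Plane) : height y x w = -height x y w := by
  rw [height, height, dist_comm y x, ← neg_div]
  ring

/-- `along` and `height` are coordinates in an orthonormal frame with origin `x` and first axis
towards `y`. -/
lemma along_sub_sq_add_height_sub_sq {x y : Plane} (hxy : x ≠ y) (w w' : Plane) :
    (along x y w - along x y w') ^ 2 + (height x y w - height x y w') ^ 2 = dist w w' ^ 2 := by
  have h := dist_pos.2 hxy
  have h2 := plane_dist_sq y x
  rw [dist_comm] at h2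
  have e1 : along x y w - along x y w' =
      ((y 0 - x 0) * (w 0 - w' 0) + (y 1 - x 1) * (w 1 - w' 1)) / dist x y := by
    rw [along, along, ← sub_div]; ring
  have e2 : height x y w - height x y w' =
      ((y 0 - x 0) * (w 1 - w' 1) - (y 1 - x 1) * (w 0 - w' 0)) / dist x y := by
    rw [height, height, ← sub_div]; ring
  rw [e1, e2, div_pow, div_pow, ← add_div, div_eq_iff (pow_ne_zero 2 h.ne'), plane_dist_sq, h2]
  ring

lemma abs_along_sub_le {x y : Plane} (hxy : x ≠ y) (w w' : Plane) :
    |along x y w - along x y w'| ≤ dist w w' := by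
  refine abs_le_of_sq_le_sq ?_ dist_nonneg
  rw [← along_sub_sq_add_height_sub_sq hxy]
  exact le_add_of_nonneg_right (sq_nonneg _)

lemma abs_height_sub_le {x y : Plane} (hxy : x ≠ y) (w w' : Plane) :
    |height x y w - height x y w'| ≤ dist w w' := by
  refine abs_le_of_sq_le_sq ?_ dist_nonneg
  rw [← along_sub_sq_add_height_sub_sq hxy]
  exact le_add_of_nonneg_left (sq_nonneg _)

lemma dist_le_along_add_height {x y : Plane} (hxy : x ≠ y) (w w' : Plane) :
    dist w w' ≤ |along x y w - along x y w'| + |height x y w - height x y w'| := by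
  refine le_of_sq_le_sq ?_ (by positivity)
  rw [← along_sub_sq_add_height_sub_sq hxy, add_sq, sq_abs, sq_abs]
  have := mul_nonneg (abs_nonneg (along x y w - along x y w'))
    (abs_nonneg (height x y w - height x y w'))
  linarith

lemma eq_of_along_eq_of_height_eq {x y : Plane} (hxy : x ≠ y) {w w' : Plane}
    (h1 : along x y w = along x y w') (h2 : height x y w = height x y w') : w = w' := by
  have := dist_le_along_add_height hxy w w'
  rw [h1, h2] at this
  simp only [sub_self, abs_zero, add_zero] at this
  exact dist_le_zero.1 this

lemma along_lineMap (x y a u : Plane) (τ : ℝ) :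
    along x y (a + τ • (u - a)) = along x y a + τ * (along x y u - along x y a) := by
  simp only [along, PiLp.add_apply, PiLp.smul_apply, PiLp.sub_apply, smul_eq_mul]
  ring

lemma height_lineMap (x y a u : Plane) (τ : ℝ) :
    height x y (a + τ • (u - a)) = height x y a + τ * (height x y u - height x y a) := by
  simp only [height, PiLp.add_apply, PiLp.smul_apply, PiLp.sub_apply, smul_eq_mul]
  ring

lemma continuous_along (x y : Plane) : Continuous (along x y) := by
  unfold along
  fun_prop

lemma continuous_height (x y : Plane) : Continuous (height x y) := by
  unfold height
  fun_prop

/-- A point of `Γ` on the ray from a base point `a` of height zero towards a point `u` of `Γ`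
visible from `a` lies at least as high as `u`. -/
lemma height_le_of_mem_visiblePart {Γ : Set Plane} {x y a u w : Plane} (hxy : x ≠ y)
    (ha : height x y a = 0) (hu : u ∈ visiblePart Γ a) (hhu : 0 < height x y u)
    (hw : w ∈ Γ) (hhw : 0 < height x y w)
    (hray : (along x y w - along x y a) * height x y u =
      (along x y u - along x y a) * height x y w) :
    height x y u ≤ height x y w := by
  by_contra hlt
  push Not at hlt
  -- A lower `w` would sit on the segment from `a` to `u`, at the ratio of the two heights, where
  -- visibility allows only `u`.
  have hτ : height x y w / height x y u ≤ 1 := (div_le_one hhu).2 hlt.le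
  have hweq : w = a + (height x y w / height x y u) • (u - a) := by
    refine eq_of_along_eq_of_height_eq hxy ?_ ?_
    · rw [along_lineMap]
      field_simp
      linarith
    · rw [height_lineMap, ha]
      field_simp
      ring
  have hseg : w ∈ segment ℝ a u := by
    rw [segment_eq_image']
    exact ⟨_, ⟨(div_pos hhw hhu).le, hτ⟩, hweq.symm⟩
  have hwu : w ∈ segment ℝ a u ∩ Γ := ⟨hseg, hw⟩
  rw [hu.2, Set.mem_singleton_iff] at hwu
  rw [hwu] at hlt
  exact lt_irrefl _ hlt

/-! ### Slope coordinates and the walled box -/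

/-- Minus the cotangent of the angle at `x` between `y` and `w`. -/
noncomputable def leftSlope (x y w : Plane) : ℝ := -along x y w / height x y w

/-- Minus the cotangent of the angle at `y` between `x` and `w`. -/
noncomputable def rightSlope (x y w : Plane) : ℝ := (along x y w - dist x y) / height x y w

/-- On the half-plane of positive height the slopes are coordinates whose coordinate lines pass
through `x` and `y`. This identity makes height an increasing function of their sum, so along a ray
from one viewpoint the slope at the other viewpoint grows with the height. -/
lemma leftSlope_add_rightSlope (x y w : Plane) :
    leftSlope x y w + rightSlope x y w = -(dist x y / height x y w) := by
  rw [leftSlope, rightSlope, ← add_div, ← neg_div]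
  ring

lemma leftSlope_mul {x y w : Plane} (h : 0 < height x y w) :
    leftSlope x y w * height x y w = -along x y w := by
  rw [leftSlope, div_mul_cancel₀ _ h.ne']

lemma rightSlope_mul {x y w : Plane} (h : 0 < height x y w) :
    rightSlope x y w * height x y w = along x y w - dist x y := by
  rw [rightSlope, div_mul_cancel₀ _ h.ne']

/-- A connected set has no point in a quadrilateral whose four sides are contained in segments
joining `x` and `y` to visible points beyond the quadrilateral. -/
lemma not_mem_walled_box {Γ : Set Plane} (hΓ : IsPreconnected Γ) {x y : Plane} (hxy : x ≠ y)
    {u₁ u₃ v₁ v₃ w : Plane}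
    (hu₁ : u₁ ∈ visiblePart Γ x) (hu₃ : u₃ ∈ visiblePart Γ x)
    (hv₁ : v₁ ∈ visiblePart Γ y) (hv₃ : v₃ ∈ visiblePart Γ y)
    (hhu₁ : 0 < height x y u₁) (hhu₃ : 0 < height x y u₃)
    (hhv₁ : 0 < height x y v₁) (hhv₃ : 0 < height x y v₃) (hhw : 0 < height x y w)
    (h₁ : rightSlope x y v₃ < rightSlope x y u₁) (h₃ : rightSlope x y v₃ < rightSlope x y u₃)
    (k₁ : leftSlope x y u₃ < leftSlope x y v₁) (k₃ : leftSlope x y u₃ < leftSlope x y v₃)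
    (hw₁ : leftSlope x y u₁ < leftSlope x y w) (hw₃ : leftSlope x y w < leftSlope x y u₃)
    (hw₁' : rightSlope x y v₁ < rightSlope x y w) (hw₃' : rightSlope x y w < rightSlope x y v₃) :
    w ∉ Γ := by
  intro hwΓ
  have hρ := dist_pos.2 hxy
  set ρ := dist x y with hρdef
  set α₁ := leftSlope x y u₁ with hα₁
  set α₃ := leftSlope x y u₃ with hα₃
  set β₁ := rightSlope x y v₁ with hβ₁
  set β₃ := rightSlope x y v₃ with hβ₃
  -- The corner with the smallest slopes has a smaller slope sum than `u₁`. Negativity of this sum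
  -- forces positive height throughout `K`.
  have hneg : α₁ + β₁ < 0 := by
    have := leftSlope_add_rightSlope x y u₁
    have h2 := div_pos hρ hhu₁
    linarith
  have hbelow : ∀ {p q : Plane}, 0 < height x y p → 0 < height x y q →
      leftSlope x y p + rightSlope x y p < leftSlope x y q + rightSlope x y q →
      height x y p < height x y q := by
    intro p q hp hq h
    rw [leftSlope_add_rightSlope, leftSlope_add_rightSlope, neg_lt_neg_iff] at h
    exact (div_lt_div_iff_of_pos_left hρ hq hp).1 h
  -- The open and closed boxes, with the height multiplied out so that both are given by
  -- inequalities between continuous functions.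
  set U : Set Plane := {p | α₁ * height x y p < -along x y p ∧ -along x y p < α₃ * height x y p ∧
    β₁ * height x y p < along x y p - ρ ∧ along x y p - ρ < β₃ * height x y p} with hU
  set K : Set Plane := {p | α₁ * height x y p ≤ -along x y p ∧ -along x y p ≤ α₃ * height x y p ∧
    β₁ * height x y p ≤ along x y p - ρ ∧ along x y p - ρ ≤ β₃ * height x y p} with hK
  have ca := continuous_along x y
  have ch := continuous_height x y
  have hUo : IsOpen U := by
    simp only [hU, Set.ofPred_and]
    refine IsOpen.inter ?_ (IsOpen.inter ?_ (IsOpen.inter ?_ ?_)) <;>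
      exact isOpen_lt (by fun_prop) (by fun_prop)
  have hKc : IsClosed K := by
    simp only [hK, Set.ofPred_and]
    refine IsClosed.inter ?_ (IsClosed.inter ?_ (IsClosed.inter ?_ ?_)) <;>
      exact isClosed_le (by fun_prop) (by fun_prop)
  have hcover : Γ ⊆ U ∪ Kᶜ := by
    intro p hp
    by_cases hpK : p ∈ K
    swap
    · exact Or.inr hpK
    left
    obtain ⟨b1, b2, b3, b4⟩ := hpK
    have hhp : 0 < height x y p := by
      by_contra hcon
      push Not at hcon
      have := mul_nonneg_of_nonpos_of_nonpos hneg.le hcon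
      nlinarith
    have eL := leftSlope_mul hhp
    have eR := rightSlope_mul hhp
    rw [← eL] at b1 b2
    rw [← eR] at b3 b4
    have c1 := le_of_mul_le_mul_right b1 hhp
    have c2 := le_of_mul_le_mul_right b2 hhp
    have c3 := le_of_mul_le_mul_right b3 hhp
    have c4 := le_of_mul_le_mul_right b4 hhp
    -- A point of `Γ` on this side of the box would lie on the ray from `x` to `u` with a smaller
    -- slope at `y`, hence strictly below `u`, which blocks the view of `u`.
    have hx : ∀ u ∈ visiblePart Γ x, 0 < height x y u → β₃ < rightSlope x y u →
        leftSlope x y p ≠ leftSlope x y u := by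
      intro u hu hhu hβ heq
      refine (hbelow hhp hhu (by linarith)).not_ge
        (height_le_of_mem_visiblePart hxy (height_left x y) hu hhu hp hhp ?_)
      have e2 := leftSlope_mul hhu
      rw [heq] at eL
      rw [along_left]
      linear_combination height x y u * eL - height x y p * e2
    have hy : ∀ v ∈ visiblePart Γ y, 0 < height x y v → α₃ < leftSlope x y v →
        rightSlope x y p ≠ rightSlope x y v := by
      intro v hv hhv hα heq
      refine (hbelow hhp hhv (by linarith)).not_ge
        (height_le_of_mem_visiblePart hxy (height_right x y) hv hhv hp hhp ?_)
      have e2 := rightSlope_mul hhv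
      rw [heq] at eR
      rw [along_right hxy]
      linear_combination (-height x y v) * eR + height x y p * e2
    refine ⟨?_, ?_, ?_, ?_⟩
    · rw [← eL]
      exact mul_lt_mul_of_pos_right (lt_of_le_of_ne c1 (hx u₁ hu₁ hhu₁ h₁).symm) hhp
    · rw [← eL]
      exact mul_lt_mul_of_pos_right (lt_of_le_of_ne c2 (hx u₃ hu₃ hhu₃ h₃)) hhp
    · rw [← eR]
      exact mul_lt_mul_of_pos_right (lt_of_le_of_ne c3 (hy v₁ hv₁ hhv₁ k₁).symm) hhp
    · rw [← eR]
      exact mul_lt_mul_of_pos_right (lt_of_le_of_ne c4 (hy v₃ hv₃ hhv₃ k₃)) hhp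
  have hwU : w ∈ U := by
    refine ⟨?_, ?_, ?_, ?_⟩
    · rw [← leftSlope_mul hhw]
      exact mul_lt_mul_of_pos_right hw₁ hhw
    · rw [← leftSlope_mul hhw]
      exact mul_lt_mul_of_pos_right hw₃ hhw
    · rw [← rightSlope_mul hhw]
      exact mul_lt_mul_of_pos_right hw₁' hhw
    · rw [← rightSlope_mul hhw]
      exact mul_lt_mul_of_pos_right hw₃' hhw
  have hu₁K : u₁ ∈ Kᶜ := by
    rintro ⟨-, -, -, b4⟩
    rw [← rightSlope_mul hhu₁] at b4
    exact h₁.not_ge (le_of_mul_le_mul_right b4 hhu₁)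
  obtain ⟨p, -, hpU, hpK⟩ := hΓ U Kᶜ hUo hKc.isOpen_compl hcover ⟨w, hwΓ, hwU⟩ ⟨u₁, hu₁.1, hu₁K⟩
  exact hpK ⟨hpU.1.le, hpU.2.1.le, hpU.2.2.1.le, hpU.2.2.2.le⟩

/-! ### Dyadic squares and elementary counting -/

/-- The index of the half-open dyadic square of side `2⁻ᵏ` containing `w`. -/
noncomputable def gridIndex (k : ℕ) (w : Plane) : ℤ × ℤ := (⌊2 ^ k * w 0⌋, ⌊2 ^ k * w 1⌋)

lemma abs_sub_le_one_of_floor_eq {a b : ℝ} (h : ⌊a⌋ = ⌊b⌋) : |a - b| ≤ 1 :=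
  (Int.abs_sub_lt_one_of_floor_eq_floor h).le

lemma abs_floor_sub_floor_le {a b : ℝ} {r : ℤ} (h : |a - b| ≤ r) : |⌊a⌋ - ⌊b⌋| ≤ r := by
  have h1 := Int.floor_le a
  have h2 := Int.lt_floor_add_one a
  have h3 := Int.floor_le b
  have h4 := Int.lt_floor_add_one b
  rw [abs_le] at h ⊢
  constructor
  · have : (-r : ℝ) - 1 < (⌊a⌋ - ⌊b⌋ : ℤ) := by push_cast; linarith
    have : -r - 1 < ⌊a⌋ - ⌊b⌋ := by exact_mod_cast this
    linarith
  · have : ((⌊a⌋ - ⌊b⌋ : ℤ) : ℝ) < r + 1 := by push_cast; linarith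
    have : ⌊a⌋ - ⌊b⌋ < r + 1 := by exact_mod_cast this
    linarith

lemma dist_le_of_gridIndex_eq {k : ℕ} {w w' : Plane} (h : gridIndex k w = gridIndex k w') :
    dist w w' ≤ 2 / 2 ^ k := by
  have h0 := abs_sub_le_one_of_floor_eq (congrArg Prod.fst h)
  have h1 := abs_sub_le_one_of_floor_eq (congrArg Prod.snd h)
  have hk : (0 : ℝ) < 2 ^ k := by positivity
  rw [← mul_sub, abs_mul, abs_of_pos hk] at h0 h1
  rw [le_div_iff₀ hk]
  refine le_of_sq_le_sq ?_ (by norm_num)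
  rw [mul_pow, plane_dist_sq, ← sq_abs (w 0 - w' 0), ← sq_abs (w 1 - w' 1)]
  have a0 := abs_nonneg (w 0 - w' 0)
  have a1 := abs_nonneg (w 1 - w' 1)
  nlinarith [mul_nonneg hk.le a0, mul_nonneg hk.le a1]

lemma gridIndex_close {k : ℕ} {w w' : Plane} {r : ℤ} (h : dist w w' ≤ r / 2 ^ k) :
    |(gridIndex k w).1 - (gridIndex k w').1| ≤ r ∧
      |(gridIndex k w).2 - (gridIndex k w').2| ≤ r := by
  have hk : (0 : ℝ) < 2 ^ k := by positivity
  rw [le_div_iff₀ hk] at h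
  have key : ∀ i : Fin 2, |2 ^ k * w i - 2 ^ k * w' i| ≤ r := by
    intro i
    rw [← mul_sub, abs_mul, abs_of_pos hk]
    have := plane_abs_sub_le_dist w w' i
    nlinarith
  exact ⟨abs_floor_sub_floor_le (key 0), abs_floor_sub_floor_le (key 1)⟩

/-- The square block of lattice points of radius `r` around `z`. -/
noncomputable def latticeBlock (z : ℤ × ℤ) (r : ℕ) : Finset (ℤ × ℤ) :=
  Finset.Icc (z.1 - r) (z.1 + r) ×ˢ Finset.Icc (z.2 - r) (z.2 + r)

lemma card_latticeBlock (z : ℤ × ℤ) (r : ℕ) : (latticeBlock z r).card = (2 * r + 1) ^ 2 := by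
  have h : ∀ c : ℤ, (c + r + 1 - (c - r)).toNat = 2 * r + 1 := by intro c; omega
  rw [latticeBlock, Finset.card_product, Int.card_Icc, Int.card_Icc, h, h, sq]

lemma mem_latticeBlock {z z' : ℤ × ℤ} {r : ℕ} (h1 : |z'.1 - z.1| ≤ r) (h2 : |z'.2 - z.2| ≤ r) :
    z' ∈ latticeBlock z r := by
  rw [abs_le] at h1 h2
  simp only [latticeBlock, Finset.mem_product, Finset.mem_Icc]
  omega

lemma gridIndex_mem_latticeBlock {k : ℕ} {w w' : Plane} {r : ℕ} (h : dist w' w ≤ r / 2 ^ k) :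
    gridIndex k w' ∈ latticeBlock (gridIndex k w) r := by
  have h' := gridIndex_close (k := k) (w := w') (w' := w) (r := (r : ℤ)) (by rwa [Int.cast_natCast])
  exact mem_latticeBlock h'.1 h'.2

/-- With `r = 2` this is the source of the factor 25: marked points that agree up to 2⁻ᵏ in both
orthonormal coordinates are at most two side lengths apart. -/
lemma card_le_of_pairwise_dist_le {k : ℕ} (Z : Finset (ℤ × ℤ)) (u : ℤ × ℤ → Plane) (r : ℕ)
    (hu : ∀ z ∈ Z, gridIndex k (u z) = z)
    (hdist : ∀ z ∈ Z, ∀ z' ∈ Z, dist (u z) (u z') ≤ r / 2 ^ k) : Z.card ≤ (2 * r + 1) ^ 2 := by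
  rcases Z.eq_empty_or_nonempty with rfl | ⟨z, hz⟩
  · simp
  rw [← card_latticeBlock z r]
  refine Finset.card_le_card fun z' hz' => ?_
  have := gridIndex_mem_latticeBlock (hdist z' hz' z hz)
  rwa [hu z hz, hu z' hz'] at this

lemma card_image_floor_le {α : Type*} (S : Finset α) (f : α → ℝ) (c : ℝ) (hc : 0 ≤ c)
    (hf : ∀ a ∈ S, ∀ b ∈ S, |f a - f b| ≤ c) :
    ((S.image fun a => ⌊f a⌋).card : ℝ) ≤ c + 2 := by
  rcases S.eq_empty_or_nonempty with rfl | hne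
  · simp only [Finset.image_empty, Finset.card_empty, Nat.cast_zero]
    linarith
  obtain ⟨a, ha, hmin⟩ := S.exists_min_image f hne
  have hsub : (S.image fun a => ⌊f a⌋) ⊆ Finset.Icc ⌊f a⌋ (⌊f a⌋ + (⌊c⌋ + 1)) := by
    intro i hi
    obtain ⟨b, hb, rfl⟩ := Finset.mem_image.1 hi
    rw [Finset.mem_Icc]
    refine ⟨Int.floor_le_floor (hmin b hb), ?_⟩
    have h1 := (abs_le.1 (hf b hb a ha)).2
    have h2 := Int.floor_le (f b)
    have h3 := Int.lt_floor_add_one (f a)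
    have h4 := Int.lt_floor_add_one c
    have : (⌊f b⌋ : ℝ) < (⌊f a⌋ + (⌊c⌋ + 1) + 1 : ℤ) := by push_cast; linarith
    have : ⌊f b⌋ < ⌊f a⌋ + (⌊c⌋ + 1) + 1 := by exact_mod_cast this
    linarith
  have h1 := Finset.card_le_card hsub
  rw [Int.card_Icc] at h1
  have hc0 : 0 ≤ ⌊c⌋ := Int.floor_nonneg.2 hc
  have h2 : (⌊f a⌋ + (⌊c⌋ + 1) + 1 - ⌊f a⌋).toNat = ⌊c⌋.toNat + 2 := by omega
  rw [h2] at h1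
  have h3 : ((⌊c⌋.toNat : ℕ) : ℝ) = ((⌊c⌋ : ℤ) : ℝ) := by
    exact_mod_cast congrArg (Int.cast : ℤ → ℝ) (Int.toNat_of_nonneg hc0)
  have h4 := Int.floor_le c
  calc ((S.image fun a => ⌊f a⌋).card : ℝ) ≤ ((⌊c⌋.toNat + 2 : ℕ) : ℝ) := by exact_mod_cast h1
    _ = (⌊c⌋ : ℝ) + 2 := by push_cast; rw [h3]
    _ ≤ c + 2 := by linarith

lemma card_le_mul_of_fibers {α β : Type*} [DecidableEq β] (S : Finset α) (f : α → β) {b c : ℝ}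
    (hb : 0 ≤ b) (hfib : ∀ i, ((S.filter fun a => f a = i).card : ℝ) ≤ b)
    (himage : ((S.image f).card : ℝ) ≤ c) : (S.card : ℝ) ≤ c * b := by
  rw [Finset.card_eq_sum_card_image f S, Nat.cast_sum]
  calc ∑ i ∈ S.image f, ((S.filter fun a => f a = i).card : ℝ)
      ≤ ∑ _i ∈ S.image f, b := Finset.sum_le_sum fun i _ => hfib i
    _ = (S.image f).card * b := by rw [Finset.sum_const, nsmul_eq_mul]
    _ ≤ c * b := mul_le_mul_of_nonneg_right himage hb

/-- Stability of slopes under small displacements: the numerator error costs `e / H`, the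
denominator error `R * e / H ^ 2`, and `H ≤ R` merges the two. -/
lemma abs_div_sub_div_le {p p' h h' H R e : ℝ} (hH : 0 < H) (hHR : H ≤ R) (hh : H ≤ h)
    (hh' : H ≤ h') (hp' : |p'| ≤ R) (hpe : |p - p'| ≤ e) (hhe : |h - h'| ≤ e) :
    |p / h - p' / h'| ≤ 2 * R * e / H ^ 2 := by
  have e0 : 0 ≤ e := (abs_nonneg _).trans hpe
  have h0 : 0 < h := hH.trans_le hh
  have h0' : 0 < h' := hH.trans_le hh'
  have heq : p / h - p' / h' = (p - p') / h - p' * (h - h') / (h * h') := by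
    field_simp
    ring
  rw [heq]
  have b1 : |(p - p') / h| ≤ R * e / H ^ 2 := by
    rw [abs_div, abs_of_pos h0, div_le_div_iff₀ h0 (by positivity)]
    have : |p - p'| * H ≤ e * h := mul_le_mul hpe hh hH.le e0
    nlinarith [mul_nonneg e0 h0.le]
  have b2 : |p' * (h - h') / (h * h')| ≤ R * e / H ^ 2 := by
    rw [abs_div, abs_mul, abs_of_pos (mul_pos h0 h0')]
    refine div_le_div₀ (by nlinarith) (mul_le_mul hp' hhe (abs_nonneg _) (by linarith))
      (by positivity) ?_
    nlinarith
  have := abs_sub ((p - p') / h) (p' * (h - h') / (h * h'))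
  calc _ ≤ _ := this
    _ ≤ R * e / H ^ 2 + R * e / H ^ 2 := add_le_add b1 b2
    _ = _ := by ring

/-! ### Squares common to two visible parts -/

/-- The number of dyadic squares of side `2⁻ᵏ` that meet both visible parts in points of height
comparable to `H` above the line through `x` and `y`. -/
lemma card_slab_le {Γ : Set Plane} (hΓ : IsPreconnected Γ) {x y : Plane} (hxy : x ≠ y)
    {R H : ℝ} (hρR : dist x y ≤ R) (k L : ℕ) (Z : Finset (ℤ × ℤ))
    (u v : ℤ × ℤ → Plane) (hu : ∀ z ∈ Z, u z ∈ visiblePart Γ x)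
    (hv : ∀ z ∈ Z, v z ∈ visiblePart Γ y) (hug : ∀ z ∈ Z, gridIndex k (u z) = z)
    (hvg : ∀ z ∈ Z, gridIndex k (v z) = z)
    (hux : ∀ z ∈ Z, dist (u z) x ≤ R) (hvx : ∀ z ∈ Z, dist (v z) x ≤ R)
    (hvy : ∀ z ∈ Z, dist (v z) y ≤ R)
    (hH : 8 ≤ H * 2 ^ k) (hHR : H ≤ R) (hL : R * 2 ^ k ≤ 2 ^ L)
    (hhu : ∀ z ∈ Z, H ≤ height x y (u z) ∧ height x y (u z) ≤ 5 * H)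
    (hhv : ∀ z ∈ Z, H ≤ height x y (v z) ∧ height x y (v z) ≤ 5 * H) :
    (Z.card : ℝ) ≤ 1849200 * R ^ 2 * (L + 2) * 2 ^ k / dist x y := by
  have hk : (0 : ℝ) < 2 ^ k := by positivity
  have hH0 : 0 < H := by
    by_contra hcon
    push Not at hcon
    nlinarith
  have hR0 : 0 < R := hH0.trans_le hHR
  have hρ := dist_pos.2 hxy
  set ρ := dist x y with hρdef
  have hpx : ∀ w : Plane, dist w x ≤ R → |along x y w| ≤ R := fun w hw => by
    have := abs_along_sub_le hxy w x
    rw [along_left, sub_zero] at this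
    exact this.trans hw
  have hpy : ∀ w : Plane, dist w y ≤ R → |along x y w - ρ| ≤ R := fun w hw => by
    have := abs_along_sub_le hxy w y
    rw [along_right hxy] at this
    exact this.trans hw
  -- The resolution of the slopes: between two points of one square, both at height at least `H`,
  -- either slope changes by at most `W`.
  set W : ℝ := 4 * R / (2 ^ k * H ^ 2) with hW
  have hW0 : 0 < W := by positivity
  have huv : ∀ z ∈ Z, dist (u z) (v z) ≤ 2 / 2 ^ k := fun z hz =>
    dist_le_of_gridIndex_eq ((hug z hz).trans (hvg z hz).symm)
  have hWeq : 2 * R * (2 / 2 ^ k) / H ^ 2 = W := by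
    rw [hW]; field_simp; norm_num
  have hleft : ∀ z ∈ Z, |leftSlope x y (u z) - leftSlope x y (v z)| ≤ W := by
    intro z hz
    rw [← hWeq]
    refine abs_div_sub_div_le hH0 hHR (hhu z hz).1 (hhv z hz).1 ?_ ?_ ?_
    · rw [abs_neg]; exact hpx _ (hvx z hz)
    · rw [neg_sub_neg, abs_sub_comm]; exact (abs_along_sub_le hxy _ _).trans (huv z hz)
    · exact (abs_height_sub_le hxy _ _).trans (huv z hz)
  have hright : ∀ z ∈ Z, |rightSlope x y (u z) - rightSlope x y (v z)| ≤ W := by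
    intro z hz
    rw [← hWeq]
    refine abs_div_sub_div_le hH0 hHR (hhu z hz).1 (hhv z hz).1 (hpy _ (hvy z hz)) ?_ ?_
    · rw [sub_sub_sub_cancel_right]; exact (abs_along_sub_le hxy _ _).trans (huv z hz)
    · exact (abs_height_sub_le hxy _ _).trans (huv z hz)
  have hslope : ∀ p h : ℝ, |p| ≤ R → H ≤ h → |p / h| ≤ R / H := by
    intro p h hp hh
    rw [abs_div, abs_of_pos (hH0.trans_le hh)]
    exact div_le_div₀ hR0.le hp hH0 hh
  have hleftR : ∀ z ∈ Z, |leftSlope x y (u z)| ≤ R / H := fun z hz =>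
    hslope _ _ (by rw [abs_neg]; exact hpx _ (hux z hz)) (hhu z hz).1
  have hrightR : ∀ z ∈ Z, |rightSlope x y (v z)| ≤ R / H := fun z hz =>
    hslope _ _ (hpy _ (hvy z hz)) (hhv z hz).1
  have hrangeW : 2 * (R / H) / W = H * 2 ^ k / 2 := by
    rw [hW]; field_simp; norm_num
  have hrange : ∀ a b : ℝ, |a| ≤ R / H → |b| ≤ R / H → |a / W - b / W| ≤ H * 2 ^ k / 2 := by
    intro a b ha hb
    rw [← sub_div, abs_div, abs_of_pos hW0, ← hrangeW]
    refine div_le_div_of_nonneg_right ?_ hW0.le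
    have := abs_sub a b
    linarith
  -- The column comes from the point visible from `x`, the row from the point visible from `y`, so
  -- that a column or row index locates an actual wall.
  set cell : ℤ × ℤ → ℤ × ℤ := fun z => (⌊leftSlope x y (u z) / W⌋, ⌊rightSlope x y (v z) / W⌋)
    with hcell
  set G := Z.image cell with hG
  -- Each slope spans at most `H * 2 ^ k / 2` cell widths; the two extra cells at the ends fit
  -- because `8 ≤ H * 2 ^ k`.
  set n := ⌊H * 2 ^ k⌋₊ with hn
  have hcol : (G.image Prod.fst).card ≤ n := by
    refine Nat.le_floor ?_
    have : G.image Prod.fst = Z.image fun z => ⌊leftSlope x y (u z) / W⌋ := by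
      rw [hG, Finset.image_image]; rfl
    rw [this]
    refine (card_image_floor_le Z _ (H * 2 ^ k / 2) (by positivity) fun a ha b hb =>
      hrange _ _ (hleftR a ha) (hleftR b hb)).trans ?_
    linarith
  have hrow : (G.image Prod.snd).card ≤ n := by
    refine Nat.le_floor ?_
    have : G.image Prod.snd = Z.image fun z => ⌊rightSlope x y (v z) / W⌋ := by
      rw [hG, Finset.image_image]; rfl
    rw [this]
    refine (card_image_floor_le Z _ (H * 2 ^ k / 2) (by positivity) fun a ha b hb =>
      hrange _ _ (hrightR a ha) (hrightR b hb)).trans ?_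
    linarith
  have hGrange : ∀ a ∈ G, ∀ b ∈ G, a.2 - b.2 < 2 ^ L := by
    intro a ha b hb
    obtain ⟨z, hz, rfl⟩ := Finset.mem_image.1 ha
    obtain ⟨z', hz', rfl⟩ := Finset.mem_image.1 hb
    have h1 := (abs_le.1 (hrange _ _ (hrightR z hz) (hrightR z' hz'))).2
    have h2 := Int.floor_le (rightSlope x y (v z) / W)
    have h3 := Int.lt_floor_add_one (rightSlope x y (v z') / W)
    have h4 : H * 2 ^ k ≤ R * 2 ^ k := mul_le_mul_of_nonneg_right hHR hk.le
    have : (((cell z).2 - (cell z').2 : ℤ) : ℝ) < ((2 ^ L : ℤ) : ℝ) := by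
      push_cast
      simp only [hcell]
      linarith
    exact_mod_cast this
  have hfloor : ∀ s : ℝ, ⌊s / W⌋ * W ≤ s ∧ s < (⌊s / W⌋ + 1) * W := fun s =>
    ⟨(le_div_iff₀ hW0).1 (Int.floor_le _), (div_lt_iff₀ hW0).1 (Int.lt_floor_add_one _)⟩
  -- Indices two apart leave more than `W` between the slopes, enough to absorb replacing `u z` by
  -- `v z` in the same square.
  have hgap : ∀ i j : ℤ, i + 2 ≤ j → ((i : ℝ) + 2) * W ≤ j * W := by
    intro i j hij
    refine mul_le_mul_of_nonneg_right ?_ hW0.le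
    exact_mod_cast hij
  have hGcard : G.card ≤ 4 * (n * (4 + 2 * L)) := by
    refine card_le_of_avoids_separated_walls G n L hcol hrow hGrange ?_
    intro i₁ i₂ i₃ j₁ j₂ j₃ a b c d h1 h2 h3 h4 h5 h6 h7 h8 m1 m2 m3 m4 m5
    obtain ⟨z₁, hz₁, e₁⟩ := Finset.mem_image.1 m1
    obtain ⟨z₂, hz₂, e₂⟩ := Finset.mem_image.1 m2
    obtain ⟨z₃, hz₃, e₃⟩ := Finset.mem_image.1 m3
    obtain ⟨z₄, hz₄, e₄⟩ := Finset.mem_image.1 m4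
    obtain ⟨z₅, hz₅, e₅⟩ := Finset.mem_image.1 m5
    simp only [hcell, Prod.mk.injEq] at e₁ e₂ e₃ e₄ e₅
    have L₁ := hfloor (leftSlope x y (u z₁))
    have L₂ := hfloor (leftSlope x y (u z₂))
    have L₃ := hfloor (leftSlope x y (u z₃))
    have L₄ := hfloor (leftSlope x y (u z₄))
    have L₅ := hfloor (leftSlope x y (u z₅))
    have R₁ := hfloor (rightSlope x y (v z₁))
    have R₂ := hfloor (rightSlope x y (v z₂))
    have R₃ := hfloor (rightSlope x y (v z₃))
    have R₄ := hfloor (rightSlope x y (v z₄))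
    have R₅ := hfloor (rightSlope x y (v z₅))
    rw [e₁.1] at L₁
    rw [e₁.2] at R₁
    rw [e₂.1] at L₂
    rw [e₂.2] at R₂
    rw [e₃.1] at L₃
    rw [e₃.2] at R₃
    rw [e₄.1] at L₄
    rw [e₄.2] at R₄
    rw [e₅.1] at L₅
    rw [e₅.2] at R₅
    have g1 := hgap _ _ h1
    have g2 := hgap _ _ h2
    have g3 := hgap _ _ h3
    have g4 := hgap _ _ h4
    have g5 := hgap _ _ h5
    have g6 := hgap _ _ h6
    have g7 := hgap _ _ h7
    have g8 := hgap _ _ h8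
    have s1 := abs_le.1 (hright z₁ hz₁)
    have s2 := abs_le.1 (hright z₂ hz₂)
    have s3 := abs_le.1 (hright z₃ hz₃)
    have s4 := abs_le.1 (hleft z₄ hz₄)
    have s5 := abs_le.1 (hleft z₅ hz₅)
    refine not_mem_walled_box hΓ hxy (hu z₁ hz₁) (hu z₂ hz₂) (hv z₄ hz₄) (hv z₅ hz₅)
      (hH0.trans_le (hhu z₁ hz₁).1) (hH0.trans_le (hhu z₂ hz₂).1) (hH0.trans_le (hhv z₄ hz₄).1)
      (hH0.trans_le (hhv z₅ hz₅).1) (hH0.trans_le (hhu z₃ hz₃).1) ?_ ?_ ?_ ?_ ?_ ?_ ?_ ?_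
      (hu z₃ hz₃).1 <;> linarith
  -- Within a cell the sum of the slopes varies by at most `4 * W`, so the height varies by at most
  -- `400 * R / ρ` side lengths. In each layer one side length thick, the position along the line
  -- varies by at most `21 * R / H` side lengths. The resulting `1 / H` cancels the `H` in the
  -- number of cells, so the final bound does not depend on `H`.
  have hfiber : ∀ g, ((Z.filter fun z => cell z = g).card : ℝ) ≤
      (402 * R / ρ) * ((23 * R / H) * 25) := by
    intro g
    set F := Z.filter fun z => cell z = g with hF
    have hFZ : ∀ z ∈ F, z ∈ Z := fun z hz => (Finset.mem_filter.1 hz).1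
    have hsame : ∀ a b : ℝ, ⌊a / W⌋ = ⌊b / W⌋ → |a - b| ≤ W := by
      intro a b hab
      have := abs_sub_le_one_of_floor_eq hab
      rwa [← sub_div, abs_div, abs_of_pos hW0, div_le_one hW0] at this
    have hFleft : ∀ z ∈ F, ∀ z' ∈ F, |leftSlope x y (u z) - leftSlope x y (u z')| ≤ W := by
      intro z hz z' hz'
      have h := (Finset.mem_filter.1 hz).2.trans (Finset.mem_filter.1 hz').2.symm
      exact hsame _ _ (congrArg Prod.fst h)
    have hFright : ∀ z ∈ F, ∀ z' ∈ F, |rightSlope x y (u z) - rightSlope x y (u z')| ≤ 3 * W := by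
      intro z hz z' hz'
      have h := (Finset.mem_filter.1 hz).2.trans (Finset.mem_filter.1 hz').2.symm
      have h0 := abs_le.1 (hsame _ _ (congrArg Prod.snd h))
      have h1 := abs_le.1 (hright z (hFZ z hz))
      have h2 := abs_le.1 (hright z' (hFZ z' hz'))
      rw [abs_le]
      constructor <;> linarith
    have hFheight : ∀ z ∈ F, ∀ z' ∈ F,
        |2 ^ k * height x y (u z) - 2 ^ k * height x y (u z')| ≤ 400 * R / ρ := by
      intro z hz z' hz'
      have ha := hhu z (hFZ z hz)
      have hb := hhu z' (hFZ z' hz')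
      have ha0 := hH0.trans_le ha.1
      have hb0 := hH0.trans_le hb.1
      have e := leftSlope_add_rightSlope x y (u z)
      have e' := leftSlope_add_rightSlope x y (u z')
      have h1 := abs_le.1 (hFleft z hz z' hz')
      have h2 := abs_le.1 (hFright z hz z' hz')
      have h3 : |ρ / height x y (u z) - ρ / height x y (u z')| ≤ 4 * W := by
        rw [abs_le]
        constructor <;> linarith
      set a := height x y (u z)
      set b := height x y (u z')
      have h4 : 2 ^ k * a - 2 ^ k * b = -(2 ^ k * (a * b) / ρ * (ρ / a - ρ / b)) := by
        field_simp
        ring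
      have hab : a * b ≤ 25 * H ^ 2 := by nlinarith [mul_le_mul ha.2 hb.2 hb0.le (by linarith)]
      rw [h4, abs_neg, abs_mul, abs_of_pos (by positivity)]
      calc 2 ^ k * (a * b) / ρ * |ρ / a - ρ / b|
          ≤ 2 ^ k * (25 * H ^ 2) / ρ * (4 * W) := by gcongr
        _ = 400 * R / ρ := by rw [hW]; field_simp; norm_num
    refine card_le_mul_of_fibers F (fun z => ⌊2 ^ k * height x y (u z)⌋) (by positivity) ?_ ?_
    · intro i
      set F' := F.filter fun z => ⌊2 ^ k * height x y (u z)⌋ = i with hF'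
      have hF'F : ∀ z ∈ F', z ∈ F := fun z hz => (Finset.mem_filter.1 hz).1
      have hF'height : ∀ z ∈ F', ∀ z' ∈ F',
          |height x y (u z) - height x y (u z')| ≤ 1 / 2 ^ k := by
        intro z hz z' hz'
        have h := (Finset.mem_filter.1 hz).2.trans (Finset.mem_filter.1 hz').2.symm
        have := abs_sub_le_one_of_floor_eq h
        rw [← mul_sub, abs_mul, abs_of_pos hk] at this
        rw [le_div_iff₀ hk]
        linarith
      refine card_le_mul_of_fibers F' (fun z => ⌊2 ^ k * along x y (u z)⌋) (by norm_num) ?_ ?_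
      · intro j
        refine le_trans (Nat.cast_le.2 (card_le_of_pairwise_dist_le (k := k) _ u 2 ?_ ?_))
          (by norm_num)
        · intro z hz
          exact hug z (hFZ z (hF'F z (Finset.mem_filter.1 hz).1))
        · intro z hz z' hz'
          have h := (Finset.mem_filter.1 hz).2.trans (Finset.mem_filter.1 hz').2.symm
          have h1 := abs_sub_le_one_of_floor_eq h
          rw [← mul_sub, abs_mul, abs_of_pos hk, ← le_div_iff₀' hk] at h1
          have h2 := hF'height z (Finset.mem_filter.1 hz).1 z' (Finset.mem_filter.1 hz').1
          have h3 := dist_le_along_add_height hxy (u z) (u z')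
          have h4 : ((2 : ℕ) : ℝ) / 2 ^ k = 1 / 2 ^ k + 1 / 2 ^ k := by push_cast; ring
          linarith
      · have hbound : 21 * R / H + 2 ≤ 23 * R / H := by
          have : 1 ≤ R / H := (one_le_div hH0).2 hHR
          have e1 : 21 * R / H = 21 * (R / H) := by ring
          have e2 : 23 * R / H = 23 * (R / H) := by ring
          linarith
        refine (card_image_floor_le F' _ (21 * R / H) (by positivity) ?_).trans hbound
        intro z hz z' hz'
        have hzZ := hFZ z (hF'F z hz)
        have hzZ' := hFZ z' (hF'F z' hz')
        have ha := hhu z hzZ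
        have hb := hhu z' hzZ'
        have e := leftSlope_mul (hH0.trans_le ha.1)
        have e' := leftSlope_mul (hH0.trans_le hb.1)
        have h1 := hFleft z (hF'F z hz) z' (hF'F z' hz')
        have h2 := hF'height z hz z' hz'
        have h3 := hleftR z' hzZ'
        set a := height x y (u z)
        set b := height x y (u z')
        set X := leftSlope x y (u z)
        set X' := leftSlope x y (u z')
        have heq : 2 ^ k * along x y (u z) - 2 ^ k * along x y (u z') =
            -(2 ^ k * ((X - X') * a + X' * (a - b))) := by
          linear_combination (2 : ℝ) ^ k * e - 2 ^ k * e'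
        have ha0 : 0 < a := hH0.trans_le ha.1
        rw [heq, abs_neg, abs_mul, abs_of_pos hk]
        calc 2 ^ k * |(X - X') * a + X' * (a - b)|
            ≤ 2 ^ k * (|X - X'| * a + |X'| * |a - b|) := by
              refine mul_le_mul_of_nonneg_left ?_ hk.le
              refine (abs_add_le _ _).trans ?_
              rw [abs_mul, abs_mul, abs_of_pos ha0]
          _ ≤ 2 ^ k * (W * (5 * H) + R / H * (1 / 2 ^ k)) := by
              gcongr
              exact ha.2
          _ = 21 * R / H := by rw [hW]; field_simp; norm_num
    · have hbound : 400 * R / ρ + 2 ≤ 402 * R / ρ := by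
        have : 1 ≤ R / ρ := (one_le_div hρ).2 hρR
        have e1 : 400 * R / ρ = 400 * (R / ρ) := by ring
        have e2 : 402 * R / ρ = 402 * (R / ρ) := by ring
        linarith
      exact (card_image_floor_le F _ (400 * R / ρ) (by positivity) hFheight).trans hbound
  have hGreal : (G.card : ℝ) ≤ 4 * (H * 2 ^ k * (4 + 2 * L)) := by
    have h1 : (G.card : ℝ) ≤ ((4 * (n * (4 + 2 * L)) : ℕ) : ℝ) := by exact_mod_cast hGcard
    push_cast at h1
    have h2 : (n : ℝ) ≤ H * 2 ^ k := Nat.floor_le (by positivity)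
    refine h1.trans ?_
    gcongr
  refine (card_le_mul_of_fibers Z cell (by positivity) hfiber hGreal).trans (le_of_eq ?_)
  field_simp
  ring

/-- The number of dyadic squares of side `2⁻ᵏ` that meet both visible parts in points lying above
the line through `x` and `y` and not too close to it. -/
lemma card_above_le {Γ : Set Plane} (hΓ : IsPreconnected Γ) {x y : Plane} (hxy : x ≠ y)
    {R : ℝ} (hρR : dist x y ≤ R) (k r : ℕ) (hr : R ≤ 2 ^ r) (Z : Finset (ℤ × ℤ))
    (u v : ℤ × ℤ → Plane) (hu : ∀ z ∈ Z, u z ∈ visiblePart Γ x)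
    (hv : ∀ z ∈ Z, v z ∈ visiblePart Γ y) (hug : ∀ z ∈ Z, gridIndex k (u z) = z)
    (hvg : ∀ z ∈ Z, gridIndex k (v z) = z)
    (hΓx : ∀ w ∈ Γ, dist w x ≤ R) (hΓy : ∀ w ∈ Γ, dist w y ≤ R)
    (hhu : ∀ z ∈ Z, 16 * R / (2 ^ k * dist x y) ≤ height x y (u z)) :
    (Z.card : ℝ) ≤ (k + r) * (1849200 * R ^ 2 * (k + r + 2) * 2 ^ k / dist x y) := by
  have hk : (0 : ℝ) < 2 ^ k := by positivity
  have hρ := dist_pos.2 hxy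
  have hR0 : 0 < R := hρ.trans_le hρR
  set ρ := dist x y with hρdef
  set θ := 16 * R / (2 ^ k * ρ) with hθ
  have hθ0 : 0 < θ := by positivity
  have hθk : 16 ≤ θ * 2 ^ k := by
    have e : θ * 2 ^ k = 16 * (R / ρ) := by rw [hθ]; field_simp
    have : 1 ≤ R / ρ := (one_le_div hρ).2 hρR
    linarith
  have hheight : ∀ w ∈ Γ, height x y w ≤ R := fun w hw => by
    have := (le_abs_self _).trans (abs_height_sub_le hxy w x)
    rw [height_left, sub_zero] at this
    exact this.trans (hΓx w hw)
  have hlevel : ∀ z ∈ Z, θ * 2 ^ Nat.log 2 ⌊height x y (u z) / θ⌋₊ ≤ height x y (u z) ∧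
      height x y (u z) ≤ 2 * (θ * 2 ^ Nat.log 2 ⌊height x y (u z) / θ⌋₊) := by
    intro z hz
    have h1 : 1 ≤ height x y (u z) / θ := (one_le_div hθ0).2 (hhu z hz)
    have h2 : ⌊height x y (u z) / θ⌋₊ ≠ 0 := by
      have : 1 ≤ ⌊height x y (u z) / θ⌋₊ := Nat.le_floor (by exact_mod_cast h1)
      omega
    have h3 : (2 : ℝ) ^ Nat.log 2 ⌊height x y (u z) / θ⌋₊ ≤ ⌊height x y (u z) / θ⌋₊ := by
      exact_mod_cast Nat.pow_log_le_self 2 h2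
    have h4 : ((⌊height x y (u z) / θ⌋₊ : ℝ)) + 1 ≤
        2 ^ (Nat.log 2 ⌊height x y (u z) / θ⌋₊ + 1) := by
      exact_mod_cast Nat.lt_pow_succ_log_self (by norm_num) _
    have h5 := Nat.floor_le (zero_le_one.trans h1)
    have h6 := Nat.lt_floor_add_one (height x y (u z) / θ)
    rw [pow_succ] at h4
    constructor
    · rw [mul_comm, ← le_div_iff₀ hθ0]
      linarith
    · have : height x y (u z) / θ ≤ 2 ^ Nat.log 2 ⌊height x y (u z) / θ⌋₊ * 2 := by linarith
      rw [div_le_iff₀ hθ0] at this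
      linarith
  refine card_le_mul_of_fibers Z (fun z => Nat.log 2 ⌊height x y (u z) / θ⌋₊)
    (by positivity) ?_ ?_
  · intro l
    rcases (Z.filter fun z => Nat.log 2 ⌊height x y (u z) / θ⌋₊ = l).eq_empty_or_nonempty with
      hem | ⟨z₀, hz₀⟩
    · rw [hem, Finset.card_empty, Nat.cast_zero]
      positivity
    set F := Z.filter fun z => Nat.log 2 ⌊height x y (u z) / θ⌋₊ = l with hF
    have hFZ : ∀ z ∈ F, z ∈ Z := fun z hz => (Finset.mem_filter.1 hz).1
    have hFl : ∀ z ∈ F, θ * 2 ^ l ≤ height x y (u z) ∧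
        height x y (u z) ≤ 2 * (θ * 2 ^ l) := fun z hz => by
      have h := hlevel z (hFZ z hz)
      rwa [(Finset.mem_filter.1 hz).2] at h
    have hl1 : θ ≤ θ * 2 ^ l := le_mul_of_one_le_right hθ0.le (one_le_pow₀ (by norm_num))
    have hstep : 2 / 2 ^ k ≤ θ * 2 ^ l / 2 / 4 := by
      rw [div_le_iff₀ hk]
      nlinarith
    have huv : ∀ z ∈ F, |height x y (u z) - height x y (v z)| ≤ θ * 2 ^ l / 2 / 4 := fun z hz =>
      ((abs_height_sub_le hxy _ _).trans (dist_le_of_gridIndex_eq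
        ((hug z (hFZ z hz)).trans (hvg z (hFZ z hz)).symm))).trans hstep
    have hpos : 0 < θ * 2 ^ l := by positivity
    -- With this `H`, the heights of the `u z` lie between `2 * H` and `4 * H`, and those of the `v
    -- z` differ from them by at most `H / 4`, so all lie between `H` and `5 * H`.
    have key := card_slab_le hΓ hxy (H := θ * 2 ^ l / 2) hρR k (k + r) F u v
      (fun z hz => hu z (hFZ z hz)) (fun z hz => hv z (hFZ z hz))
      (fun z hz => hug z (hFZ z hz)) (fun z hz => hvg z (hFZ z hz))
      (fun z hz => hΓx _ (hu z (hFZ z hz)).1) (fun z hz => hΓx _ (hv z (hFZ z hz)).1)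
      (fun z hz => hΓy _ (hv z (hFZ z hz)).1)
      (by nlinarith)
      (by
        have h1 := (hFl z₀ hz₀).1
        have h2 := hheight _ (hu z₀ (hFZ z₀ hz₀)).1
        linarith)
      (by
        rw [pow_add, mul_comm]
        exact mul_le_mul_of_nonneg_left hr hk.le)
      (fun z hz => by
        have := hFl z hz
        constructor <;> linarith)
      (fun z hz => by
        have h1 := hFl z hz
        have h2 := abs_le.1 (huv z hz)
        constructor <;> linarith)
    push_cast at key
    exact key
  · have hsub : (Z.image fun z => Nat.log 2 ⌊height x y (u z) / θ⌋₊) ⊆ Finset.range (k + r) := by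
      intro l hl
      obtain ⟨z, hz, rfl⟩ := Finset.mem_image.1 hl
      rw [Finset.mem_range]
      have h1 := (hlevel z hz).1
      have h2 := hheight _ (hu z hz).1
      have h3 : (2 : ℝ) ^ Nat.log 2 ⌊height x y (u z) / θ⌋₊ < 2 ^ (k + r) := by
        rw [pow_add]
        set q : ℝ := 2 ^ Nat.log 2 ⌊height x y (u z) / θ⌋₊
        have h4 : θ * q ≤ R := h1.trans h2
        have h5 : θ * q = R * (16 * q / (2 ^ k * ρ)) := by rw [hθ]; field_simp
        have h6 : 16 * q / (2 ^ k * ρ) ≤ 1 := by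
          by_contra hcon
          push Not at hcon
          nlinarith
        rw [div_le_one (by positivity)] at h6
        have h7 : 2 ^ k * ρ ≤ 2 ^ k * 2 ^ r :=
          mul_le_mul_of_nonneg_left (hρR.trans hr) hk.le
        have h8 : (0 : ℝ) < 2 ^ k * 2 ^ r := by positivity
        linarith
      exact (pow_lt_pow_iff_right₀ (by norm_num)).1 h3
    have := Finset.card_le_card hsub
    rw [Finset.card_range] at this
    exact_mod_cast this

/-- The number of dyadic squares of side `2⁻ᵏ` with a marked point close to the line through `x`
and `y`. -/
lemma card_strip_le {x y : Plane} (hxy : x ≠ y) {R : ℝ} (hR : 1 ≤ R) (hρR : dist x y ≤ R)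
    (k : ℕ) (Z : Finset (ℤ × ℤ)) (u : ℤ × ℤ → Plane) (hug : ∀ z ∈ Z, gridIndex k (u z) = z)
    (hux : ∀ z ∈ Z, dist (u z) x ≤ R)
    (hhu : ∀ z ∈ Z, |height x y (u z)| ≤ 18 * R / (2 ^ k * dist x y)) :
    (Z.card : ℝ) ≤ 3800 * R ^ 2 * 2 ^ k / dist x y := by
  have hk : (0 : ℝ) < 2 ^ k := by positivity
  have hk1 : (1 : ℝ) ≤ 2 ^ k := one_le_pow₀ (by norm_num)
  have hρ := dist_pos.2 hxy
  set ρ := dist x y with hρdef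
  have main : (Z.card : ℝ) ≤ (38 * R / ρ) * ((4 * R * 2 ^ k) * 25) := by
    refine card_le_mul_of_fibers Z (fun z => ⌊2 ^ k * height x y (u z)⌋) (by positivity) ?_ ?_
    · intro i
      set F := Z.filter fun z => ⌊2 ^ k * height x y (u z)⌋ = i with hF
      have hFZ : ∀ z ∈ F, z ∈ Z := fun z hz => (Finset.mem_filter.1 hz).1
      refine card_le_mul_of_fibers F (fun z => ⌊2 ^ k * along x y (u z)⌋) (by norm_num) ?_ ?_
      · intro j
        refine le_trans (Nat.cast_le.2 (card_le_of_pairwise_dist_le (k := k) _ u 2 ?_ ?_))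
          (by norm_num)
        · intro z hz
          exact hug z (hFZ z (Finset.mem_filter.1 hz).1)
        · intro z hz z' hz'
          have hz1 := Finset.mem_filter.1 hz
          have hz1' := Finset.mem_filter.1 hz'
          have h1 := abs_sub_le_one_of_floor_eq (hz1.2.trans hz1'.2.symm)
          have h2 := abs_sub_le_one_of_floor_eq
            ((Finset.mem_filter.1 hz1.1).2.trans (Finset.mem_filter.1 hz1'.1).2.symm)
          rw [← mul_sub, abs_mul, abs_of_pos hk, ← le_div_iff₀' hk] at h1 h2
          have h3 := dist_le_along_add_height hxy (u z) (u z')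
          have h4 : ((2 : ℕ) : ℝ) / 2 ^ k = 1 / 2 ^ k + 1 / 2 ^ k := by push_cast; ring
          linarith
      · refine (card_image_floor_le F _ (2 * R * 2 ^ k) (by positivity) ?_).trans (by nlinarith)
        intro z hz z' hz'
        have h1 := abs_along_sub_le hxy (u z) (u z')
        have h2 := dist_triangle_right (u z) (u z') x
        have h3 := hux z (hFZ z hz)
        have h4 := hux z' (hFZ z' hz')
        rw [← mul_sub, abs_mul, abs_of_pos hk, mul_comm]
        exact mul_le_mul_of_nonneg_right (by linarith) hk.le
    · have hbound : 36 * R / ρ + 2 ≤ 38 * R / ρ := by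
        have : 1 ≤ R / ρ := (one_le_div hρ).2 hρR
        have e1 : 36 * R / ρ = 36 * (R / ρ) := by ring
        have e2 : 38 * R / ρ = 38 * (R / ρ) := by ring
        linarith
      refine (card_image_floor_le Z _ (36 * R / ρ) (by positivity) ?_).trans hbound
      intro z hz z' hz'
      have h1 := hhu z hz
      have h2 := hhu z' hz'
      have h3 := abs_sub (height x y (u z)) (height x y (u z'))
      rw [← mul_sub, abs_mul, abs_of_pos hk]
      calc 2 ^ k * |height x y (u z) - height x y (u z')|
          ≤ 2 ^ k * (18 * R / (2 ^ k * ρ) + 18 * R / (2 ^ k * ρ)) := by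
            refine mul_le_mul_of_nonneg_left ?_ hk.le
            linarith
        _ = 36 * R / ρ := by field_simp; norm_num
  refine main.trans (le_of_eq ?_)
  field_simp
  norm_num

/-- The parts of a bounded connected set visible from two points `x` and `y` are almost disjoint:
at scale `2⁻ᵏ` they have, up to logarithmic factors, at most `2ᵏ / |x - y|` dyadic squares in
common. -/
theorem card_common_le {Γ : Set Plane} (hΓ : IsPreconnected Γ) {x y : Plane} (hxy : x ≠ y)
    {R : ℝ} (hR : 1 ≤ R) (hρR : dist x y ≤ R) (k r : ℕ) (hr : R ≤ 2 ^ r)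
    (hΓx : ∀ w ∈ Γ, dist w x ≤ R) (hΓy : ∀ w ∈ Γ, dist w y ≤ R) (Z : Finset (ℤ × ℤ))
    (hZx : ∀ z ∈ Z, ∃ u ∈ visiblePart Γ x, gridIndex k u = z)
    (hZy : ∀ z ∈ Z, ∃ v ∈ visiblePart Γ y, gridIndex k v = z) :
    (Z.card : ℝ) ≤ 4000000 * R ^ 2 * (k + r + 2) ^ 2 * 2 ^ k / dist x y := by
  have hk : (0 : ℝ) < 2 ^ k := by positivity
  have hρ := dist_pos.2 hxy
  choose! u hu hug using hZx
  choose! v hv hvg using hZy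
  set ρ := dist x y with hρdef
  set Zs := Z.filter fun z => |height x y (u z)| ≤ 18 * R / (2 ^ k * ρ) with hZs
  set Zp := Z.filter fun z => 18 * R / (2 ^ k * ρ) ≤ height x y (u z) with hZp
  set Zn := Z.filter fun z => 18 * R / (2 ^ k * ρ) ≤ -height x y (u z) with hZn
  have hcover : Z ⊆ Zs ∪ (Zp ∪ Zn) := by
    intro z hz
    simp only [hZs, hZp, hZn, Finset.mem_union, Finset.mem_filter]
    rcases le_total |height x y (u z)| (18 * R / (2 ^ k * ρ)) with h | h
    · exact Or.inl ⟨hz, h⟩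
    · rcases le_abs.1 h with h | h
      · exact Or.inr (Or.inl ⟨hz, h⟩)
      · exact Or.inr (Or.inr ⟨hz, h⟩)
  -- The margin between 16 and 18 pays for passing from `u z` to `v z`. This is needed below the
  -- line, where exchanging `x` and `y` flips the sign of the height and makes `v` the first family.
  have hthr : 16 * R / (2 ^ k * ρ) + 2 / 2 ^ k ≤ 18 * R / (2 ^ k * ρ) := by
    rw [div_add_div _ _ (by positivity) hk.ne', div_le_div_iff₀ (by positivity) (by positivity)]
    have : 2 * (2 ^ k * ρ) * (2 ^ k * (2 ^ k * ρ)) ≤ 2 * (2 ^ k * R) * (2 ^ k * (2 ^ k * ρ)) := by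
      gcongr
    nlinarith
  have h2k : 0 < 2 / (2 : ℝ) ^ k := by positivity
  have bs := card_strip_le hxy hR hρR k Zs u (fun z hz => hug z (Finset.mem_filter.1 hz).1)
    (fun z hz => hΓx _ (hu z (Finset.mem_filter.1 hz).1).1)
    (fun z hz => (Finset.mem_filter.1 hz).2)
  have bp := card_above_le hΓ hxy hρR k r hr Zp u v
    (fun z hz => hu z (Finset.mem_filter.1 hz).1) (fun z hz => hv z (Finset.mem_filter.1 hz).1)
    (fun z hz => hug z (Finset.mem_filter.1 hz).1) (fun z hz => hvg z (Finset.mem_filter.1 hz).1)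
    hΓx hΓy (fun z hz => by
      have := (Finset.mem_filter.1 hz).2
      linarith)
  have bn := card_above_le hΓ hxy.symm (by rwa [dist_comm]) k r hr Zn v u
    (fun z hz => hv z (Finset.mem_filter.1 hz).1) (fun z hz => hu z (Finset.mem_filter.1 hz).1)
    (fun z hz => hvg z (Finset.mem_filter.1 hz).1) (fun z hz => hug z (Finset.mem_filter.1 hz).1)
    hΓy hΓx (fun z hz => by
      have hz' := Finset.mem_filter.1 hz
      have h1 := (abs_height_sub_le hxy (u z) (v z)).trans (dist_le_of_gridIndex_eq
        ((hug z hz'.1).trans (hvg z hz'.1).symm))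
      have h2 := abs_le.1 h1
      rw [height_swap, dist_comm]
      linarith)
  rw [dist_comm y x] at bn
  have h1 : (Z.card : ℝ) ≤ Zs.card + (Zp.card + Zn.card) := by
    have := (Finset.card_le_card hcover).trans ((Finset.card_union_le _ _).trans
      (Nat.add_le_add_left (Finset.card_union_le _ _) _))
    exact_mod_cast this
  set A := R ^ 2 * 2 ^ k / ρ with hA
  have hA0 : 0 ≤ A := by positivity
  have e1 : 3800 * R ^ 2 * 2 ^ k / ρ = 3800 * A := by rw [hA]; ring
  have e2 : (k + r) * (1849200 * R ^ 2 * (k + r + 2) * 2 ^ k / ρ) =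
      1849200 * ((k + r) * (k + r + 2)) * A := by rw [hA]; ring
  have e3 : 4000000 * R ^ 2 * (k + r + 2) ^ 2 * 2 ^ k / ρ =
      4000000 * (k + r + 2) ^ 2 * A := by rw [hA]; ring
  rw [e1] at bs
  rw [e2] at bp bn
  rw [e3]
  have hc : (3800 : ℝ) + 2 * (1849200 * (((k : ℝ) + r) * (k + r + 2))) ≤
      4000000 * ((k : ℝ) + r + 2) ^ 2 := by
    have : (0 : ℝ) ≤ (k : ℝ) + r := by positivity
    nlinarith
  have := mul_le_mul_of_nonneg_right hc hA0
  linarith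

/-! ### Nested dyadic squares and a discrete Frostman lemma -/

lemma floor_eq_floor_two_mul_ediv (a : ℝ) : ⌊a⌋ = ⌊2 * a⌋ / 2 := by
  have h1 := Int.floor_le a
  have h2 := Int.lt_floor_add_one a
  have h3 : 2 * ⌊a⌋ ≤ ⌊2 * a⌋ := Int.le_floor.2 (by push_cast; linarith)
  have h4 : ⌊2 * a⌋ < 2 * ⌊a⌋ + 2 := Int.floor_lt.2 (by push_cast; linarith)
  omega

lemma gridIndex_eq_ediv (k : ℕ) (w : Plane) :
    gridIndex k w = ((gridIndex (k + 1) w).1 / 2, (gridIndex (k + 1) w).2 / 2) := by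
  simp only [gridIndex, pow_succ', mul_assoc]
  rw [← floor_eq_floor_two_mul_ediv, ← floor_eq_floor_two_mul_ediv]

lemma gridIndex_eq_of_le {k l : ℕ} (hkl : k ≤ l) {w w' : Plane}
    (h : gridIndex l w = gridIndex l w') : gridIndex k w = gridIndex k w' := by
  induction l, hkl using Nat.le_induction with
  | base => exact h
  | succ l _ ih =>
    refine ih ?_
    rw [gridIndex_eq_ediv l w, gridIndex_eq_ediv l w', h]

/-- The indices of the four dyadic squares into which the square with index `z` is divided. -/
def gridChildren (z : ℤ × ℤ) : Finset (ℤ × ℤ) :=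
  {2 * z.1, 2 * z.1 + 1} ×ˢ {2 * z.2, 2 * z.2 + 1}

lemma gridIndex_succ_mem_gridChildren_iff (k : ℕ) (w : Plane) (z : ℤ × ℤ) :
    gridIndex (k + 1) w ∈ gridChildren z ↔ gridIndex k w = z := by
  rw [gridIndex_eq_ediv k w]
  simp only [gridChildren, Finset.mem_product, Finset.mem_insert, Finset.mem_singleton,
    Prod.ext_iff]
  omega

lemma sum_biUnion_le_sum {α β : Type*} [DecidableEq α] [DecidableEq β] (s : Finset β)
    (t : β → Finset α) (f : α → ℝ) (hf : ∀ a, 0 ≤ f a) :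
    ∑ a ∈ s.biUnion t, f a ≤ ∑ b ∈ s, ∑ a ∈ t b, f a := by
  induction s using Finset.induction_on with
  | empty => simp
  | insert b s hb ih =>
    rw [Finset.biUnion_insert, Finset.sum_insert hb]
    have h1 := Finset.sum_union_inter (s₁ := t b) (s₂ := s.biUnion t) (f := f)
    have h2 : 0 ≤ ∑ a ∈ t b ∩ s.biUnion t, f a := Finset.sum_nonneg fun a _ => hf a
    linarith

/-- Discrete Frostman lemma: inside each dyadic square, an arbitrary set `A` contains a finite set
`P` with at most `a ^ (m - l)` points in every dyadic square of side `2⁻ˡ`, whose cardinality bounds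
the cost of some cover of `A` by dyadic squares of sides at least `2⁻ᵐ`. -/
lemma exists_discrete_frostman (A : Set Plane) {a : ℝ} (ha : 1 ≤ a) (m : ℕ) :
    ∀ j ≤ m, ∀ z : ℤ × ℤ, ∃ (P : Finset Plane) (T : Finset (ℕ × (ℤ × ℤ))),
      (∀ p ∈ P, p ∈ A) ∧ (∀ p ∈ P, gridIndex (m - j) p = z) ∧
      (∀ w ∈ A, gridIndex (m - j) w = z → ∃ τ ∈ T, gridIndex τ.1 w = τ.2) ∧
      (∀ l, m - j ≤ l → l ≤ m → ∀ z',
        ((P.filter fun p => gridIndex l p = z').card : ℝ) ≤ a ^ (m - l)) ∧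
      ∑ τ ∈ T, a⁻¹ ^ τ.1 ≤ 2 * a⁻¹ ^ m * P.card := by
  classical
  have ha0 : 0 < a := by linarith
  -- Induction from the finest squares upwards, merging the choices already made in the four
  -- children.
  intro j
  induction j with
  | zero =>
    intro _ z
    by_cases hex : ∃ w ∈ A, gridIndex m w = z
    · obtain ⟨w, hw, hwz⟩ := hex
      refine ⟨{w}, {(m, z)}, by simpa using hw, by simpa using hwz, ?_, ?_, ?_⟩
      · intro w' _ hw'
        exact ⟨(m, z), by simp, hw'⟩
      · intro l hl hlm z'
        obtain rfl : l = m := le_antisymm hlm hl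
        rw [Nat.sub_self, pow_zero]
        exact_mod_cast (Finset.card_filter_le _ _).trans (by simp)
      · simp only [Finset.sum_singleton, Finset.card_singleton, Nat.cast_one, mul_one]
        have : 0 < a⁻¹ ^ m := by positivity
        linarith
    · refine ⟨∅, ∅, by simp, by simp, ?_, ?_, by simp⟩
      · intro w hw hwz
        exact absurd ⟨w, hw, hwz⟩ hex
      · intro l _ _ z'
        simp only [Finset.filter_empty, Finset.card_empty, Nat.cast_zero]
        positivity
  | succ j ih =>
    intro hj z
    have hlev : m - (j + 1) + 1 = m - j := by omega
    choose P T hPA hPz hcov hfro hcost using ih (by omega)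
    set l₀ := m - (j + 1) with hl₀
    have hdisj : ((gridChildren z : Finset (ℤ × ℤ)) : Set (ℤ × ℤ)).PairwiseDisjoint P := by
      intro z₁ _ z₂ _ hne
      rw [Function.onFun, Finset.disjoint_left]
      intro p hp1 hp2
      exact hne ((hPz z₁ p hp1).symm.trans (hPz z₂ p hp2))
    set P' := (gridChildren z).biUnion P with hP'
    set T' := (gridChildren z).biUnion T with hT'
    have hP'A : ∀ p ∈ P', p ∈ A := by
      intro p hp
      obtain ⟨z₁, _, hp1⟩ := Finset.mem_biUnion.1 hp
      exact hPA z₁ p hp1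
    have hP'z : ∀ p ∈ P', gridIndex l₀ p = z := by
      intro p hp
      obtain ⟨z₁, hz₁, hp1⟩ := Finset.mem_biUnion.1 hp
      rw [← gridIndex_succ_mem_gridChildren_iff, hlev, hPz z₁ p hp1]
      exact hz₁
    have hP'fro : ∀ l, m - j ≤ l → l ≤ m → ∀ z',
        ((P'.filter fun p => gridIndex l p = z').card : ℝ) ≤ a ^ (m - l) := by
      intro l hl hlm z'
      rcases (P'.filter fun p => gridIndex l p = z').eq_empty_or_nonempty with hem | ⟨p₀, hp₀⟩
      · rw [hem, Finset.card_empty, Nat.cast_zero]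
        positivity
      obtain ⟨hp₀P, hp₀z⟩ := Finset.mem_filter.1 hp₀
      obtain ⟨z₀, _, hp₀'⟩ := Finset.mem_biUnion.1 hp₀P
      refine le_trans (Nat.cast_le.2 (Finset.card_le_card ?_)) (hfro z₀ l hl hlm z')
      intro p hp
      obtain ⟨hpP, hpz⟩ := Finset.mem_filter.1 hp
      obtain ⟨z₁, _, hp'⟩ := Finset.mem_biUnion.1 hpP
      have := gridIndex_eq_of_le hl (hpz.trans hp₀z.symm)
      rw [hPz z₁ p hp', hPz z₀ p₀ hp₀'] at this
      rw [this] at hp'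
      exact Finset.mem_filter.2 ⟨hp', hpz⟩
    by_cases hbig : (P'.card : ℝ) ≤ a ^ (m - l₀)
    · refine ⟨P', T', hP'A, hP'z, ?_, ?_, ?_⟩
      · intro w hw hwz
        have hmem := (gridIndex_succ_mem_gridChildren_iff l₀ w z).2 hwz
        rw [hlev] at hmem
        obtain ⟨τ, hτ, hτw⟩ := hcov _ w hw rfl
        exact ⟨τ, Finset.mem_biUnion.2 ⟨_, hmem, hτ⟩, hτw⟩
      · intro l hl hlm z'
        rcases eq_or_lt_of_le hl with rfl | hlt
        · exact le_trans (Nat.cast_le.2 (Finset.card_filter_le _ _)) hbig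
        · exact hP'fro l (by omega) hlm z'
      · have h1 : ∑ τ ∈ T', a⁻¹ ^ τ.1 ≤ ∑ z₁ ∈ gridChildren z, ∑ τ ∈ T z₁, a⁻¹ ^ τ.1 := by
          exact sum_biUnion_le_sum _ _ _ fun τ => by positivity
        refine h1.trans ((Finset.sum_le_sum fun z₁ _ => hcost z₁).trans (le_of_eq ?_))
        rw [hP', Finset.card_biUnion hdisj, Nat.cast_sum, Finset.mul_sum]
    · push Not at hbig
      -- The children supply too many points: keep only `N` and use the square itself as the cover.
      -- Its cost is at most `2 * a⁻¹ ^ m * N`, since a real number at least 1 is at most twice its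
      -- floor.
      set N := ⌊a ^ (m - l₀)⌋₊ with hN
      have hN1 : 1 ≤ N := Nat.le_floor (by exact_mod_cast one_le_pow₀ ha)
      have hNle : (N : ℝ) ≤ a ^ (m - l₀) := Nat.floor_le (by positivity)
      have hNlt : a ^ (m - l₀) < N + 1 := Nat.lt_floor_add_one _
      obtain ⟨Q, hQP, hQN⟩ := Finset.exists_subset_card_eq (s := P') (n := N)
        (by exact_mod_cast hNle.trans hbig.le)
      refine ⟨Q, {(l₀, z)}, fun p hp => hP'A p (hQP hp), fun p hp => hP'z p (hQP hp), ?_, ?_, ?_⟩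
      · intro w _ hwz
        exact ⟨(l₀, z), by simp, hwz⟩
      · intro l hl hlm z'
        rcases eq_or_lt_of_le hl with rfl | hlt
        · refine le_trans (Nat.cast_le.2 (Finset.card_filter_le _ _)) ?_
          rw [hQN]
          exact hNle
        · refine le_trans (Nat.cast_le.2 (Finset.card_le_card ?_)) (hP'fro l (by omega) hlm z')
          exact Finset.filter_subset_filter _ hQP
      · rw [Finset.sum_singleton, hQN]
        have hN1' : (1 : ℝ) ≤ N := by exact_mod_cast hN1
        have hm : a⁻¹ ^ l₀ = a⁻¹ ^ m * a ^ (m - l₀) := by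
          have : m = l₀ + (m - l₀) := by omega
          conv_rhs => rw [this, pow_add, Nat.add_sub_cancel_left]
          rw [mul_assoc, ← mul_pow, inv_mul_cancel₀ ha0.ne', one_pow, mul_one]
        simp only [hm]
        have : 0 < a⁻¹ ^ m := by positivity
        nlinarith

/-! ### Hausdorff measure and dyadic covers -/

/-- A set of positive Hausdorff measure has positive Hausdorff content. -/
lemma exists_le_tsum_ediam_of_hausdorffMeasure_ne_zero {A : Set Plane} {s : ℝ} (hs : 0 < s)
    (hA : MeasureTheory.Measure.hausdorffMeasure s A ≠ 0) :
    ∃ c : ℝ, 0 < c ∧ ∀ (ι : Type) [Countable ι] (t : ι → Set Plane), A ⊆ ⋃ i, t i →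
      ENNReal.ofReal c ≤ ∑' i, Metric.ediam (t i) ^ s := by
  by_contra hcon
  push Not at hcon
  -- Each term is bounded by the whole sum, so in covers with cost tending to zero the diameters
  -- tend to zero as well, and the covers bound the Hausdorff measure.
  have hn : ∀ n : ℕ, ∃ ι : Type, Countable ι ∧ ∃ t : ι → Set Plane, A ⊆ ⋃ i, t i ∧
      ∑' i, Metric.ediam (t i) ^ s < ENNReal.ofReal (1 / ((n : ℝ) + 1)) :=
    fun n => hcon _ (by positivity)
  choose ι hι t ht hlt using hn
  have htend : Filter.Tendsto (fun n : ℕ => ENNReal.ofReal (1 / ((n : ℝ) + 1))) Filter.atTop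
      (nhds 0) := by
    rw [← ENNReal.ofReal_zero]
    exact ENNReal.tendsto_ofReal tendsto_one_div_add_atTop_nhds_zero_nat
  have hr : Filter.Tendsto (fun n : ℕ => ENNReal.ofReal (1 / ((n : ℝ) + 1)) ^ s⁻¹) Filter.atTop
      (nhds 0) := by
    have := htend.ennrpow_const s⁻¹
    rwa [ENNReal.zero_rpow_of_pos (inv_pos.2 hs)] at this
  refine hA (le_antisymm ?_ zero_le)
  refine (MeasureTheory.Measure.hausdorffMeasure_le_liminf_tsum s A _ hr t
    (Filter.Eventually.of_forall fun n i => ?_) (Filter.Eventually.of_forall ht)).trans ?_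
  · rw [ENNReal.le_rpow_inv_iff hs]
    exact (ENNReal.le_tsum i).trans (hlt n).le
  · calc Filter.liminf (fun n => ∑' i, Metric.ediam (t n i) ^ s) Filter.atTop
        ≤ Filter.liminf (fun n : ℕ => ENNReal.ofReal (1 / ((n : ℝ) + 1))) Filter.atTop :=
          Filter.liminf_le_liminf (Filter.Eventually.of_forall fun n => (hlt n).le)
      _ = 0 := htend.liminf_eq

lemma ediam_gridIndex_fiber_rpow_le {s : ℝ} (hs : 0 < s) (k : ℕ) (z : ℤ × ℤ) :
    Metric.ediam {w : Plane | gridIndex k w = z} ^ s ≤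
      ENNReal.ofReal (2 ^ s * ((2 : ℝ) ^ s)⁻¹ ^ k) := by
  have h1 : Metric.ediam {w : Plane | gridIndex k w = z} ≤ ENNReal.ofReal (2 / 2 ^ k) := by
    refine Metric.ediam_le fun w hw w' hw' => ?_
    rw [edist_dist]
    exact ENNReal.ofReal_le_ofReal (dist_le_of_gridIndex_eq (hw.trans hw'.symm))
  refine (ENNReal.rpow_le_rpow h1 hs.le).trans (le_of_eq ?_)
  rw [ENNReal.ofReal_rpow_of_nonneg (by positivity) hs.le, Real.div_rpow (by norm_num)
    (by positivity), ← Real.rpow_natCast 2 k, ← Real.rpow_mul (by norm_num), mul_comm (k : ℝ) s,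
    Real.rpow_mul (by norm_num), Real.rpow_natCast, div_eq_mul_inv, inv_pow]

/-- The cost of a cover by dyadic squares of a set of positive Hausdorff measure is bounded below. -/
lemma exists_le_tsum_grid_of_hausdorffMeasure_ne_zero {A : Set Plane} {s : ℝ} (hs : 0 < s)
    (hA : MeasureTheory.Measure.hausdorffMeasure s A ≠ 0) :
    ∃ c : ℝ, 0 < c ∧ ∀ (ι : Type) [Countable ι] (τ : ι → ℕ × (ℤ × ℤ)),
      (∀ w ∈ A, ∃ i, gridIndex (τ i).1 w = (τ i).2) →
      ENNReal.ofReal c ≤ ∑' i, ENNReal.ofReal (((2 : ℝ) ^ s)⁻¹ ^ (τ i).1) := by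
  obtain ⟨c, hc, hcov⟩ := exists_le_tsum_ediam_of_hausdorffMeasure_ne_zero hs hA
  have h2 : (0 : ℝ) < 2 ^ s := by positivity
  refine ⟨c / 2 ^ s, by positivity, fun ι _ τ hτ => ?_⟩
  have h := hcov ι (fun i => {w | gridIndex (τ i).1 w = (τ i).2}) fun w hw => by
    obtain ⟨i, hi⟩ := hτ w hw
    exact Set.mem_iUnion.2 ⟨i, hi⟩
  rw [ENNReal.ofReal_div_of_pos h2]
  refine ENNReal.div_le_of_le_mul' (h.trans ?_)
  rw [← ENNReal.tsum_mul_left]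
  refine ENNReal.tsum_le_tsum fun i => (ediam_gridIndex_fiber_rpow_le hs _ _).trans (le_of_eq ?_)
  rw [ENNReal.ofReal_mul h2.le]

/-- If the costs of a sequence of finite families of dyadic squares are dominated by a geometric
sequence, then the families with large index do not cover a set of positive Hausdorff measure. -/
lemma exists_not_covered {A : Set Plane} {s : ℝ} (hs : 0 < s)
    (hA : MeasureTheory.Measure.hausdorffMeasure s A ≠ 0) {C q : ℝ} (hC : 0 ≤ C) (hq0 : 0 ≤ q)
    (hq : q < 1) :
    ∃ K₀ : ℕ, ∀ K ≥ K₀, ∀ T : ℕ → Finset (ℕ × (ℤ × ℤ)),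
      (∀ w ∈ A, ∃ k ≥ K, ∃ τ ∈ T k, gridIndex τ.1 w = τ.2) →
      ∃ k ≥ K, C * q ^ k < ∑ τ ∈ T k, ((2 : ℝ) ^ s)⁻¹ ^ τ.1 := by
  obtain ⟨c, hc, hcov⟩ := exists_le_tsum_grid_of_hausdorffMeasure_ne_zero hs hA
  have htend : Filter.Tendsto (fun K : ℕ => q ^ K * (C * (1 - q)⁻¹)) Filter.atTop (nhds 0) := by
    have := (tendsto_pow_atTop_nhds_zero_of_lt_one hq0 hq).mul_const (C * (1 - q)⁻¹)
    rwa [zero_mul] at this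
  obtain ⟨K₀, hK₀⟩ := Filter.eventually_atTop.1 (htend.eventually_lt_const hc)
  refine ⟨K₀, fun K hK T hT => ?_⟩
  by_contra hcon
  push Not at hcon
  have h1 := hcov (Σ n : ℕ, {τ // τ ∈ T (K + n)}) (fun i => i.2.1) fun w hw => by
    obtain ⟨k, hk, τ, hτ, h⟩ := hT w hw
    obtain ⟨n, rfl⟩ := Nat.exists_eq_add_of_le hk
    exact ⟨⟨n, τ, hτ⟩, h⟩
  rw [ENNReal.tsum_sigma'] at h1
  have h2 : ∀ n : ℕ, ∑' τ : {τ // τ ∈ T (K + n)}, ENNReal.ofReal (((2 : ℝ) ^ s)⁻¹ ^ τ.1.1) ≤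
      ENNReal.ofReal (C * q ^ (K + n)) := by
    intro n
    rw [Finset.tsum_subtype (T (K + n)) fun τ => ENNReal.ofReal (((2 : ℝ) ^ s)⁻¹ ^ τ.1),
      ← ENNReal.ofReal_sum_of_nonneg fun τ _ => by positivity]
    exact ENNReal.ofReal_le_ofReal (hcon _ (Nat.le_add_right _ _))
  have hsum : HasSum (fun n : ℕ => C * q ^ (K + n)) (q ^ K * (C * (1 - q)⁻¹)) := by
    have := (hasSum_geometric_of_lt_one hq0 hq).mul_left (q ^ K * C)
    have e : (fun n : ℕ => C * q ^ (K + n)) = fun n => q ^ K * C * q ^ n := by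
      funext n
      rw [pow_add]
      ring
    rwa [e, ← mul_assoc]
  have h3 := h1.trans (ENNReal.tsum_le_tsum h2)
  rw [← ENNReal.ofReal_tsum_of_nonneg (fun n => by positivity) hsum.summable, hsum.tsum_eq] at h3
  have h4 := (ENNReal.ofReal_le_ofReal_iff (by
    have : 0 < 1 - q := by linarith
    positivity)).1 h3
  exact (hK₀ K hK).not_ge h4

/-- If a set has positive `s`-dimensional Hausdorff measure and `s' < s`, every cover of it by
small dyadic squares uses at least `2 ^ (k s')` squares of side `2⁻ᵏ` for some `k`. -/
lemma exists_card_grid_cover_ge {A : Set Plane} {s s' : ℝ} (hs : 0 < s) (hs' : s' < s)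
    (hA : MeasureTheory.Measure.hausdorffMeasure s A ≠ 0) :
    ∃ K₀ : ℕ, ∀ K ≥ K₀, ∀ S : ℕ → Finset (ℤ × ℤ), (∀ w ∈ A, ∃ k ≥ K, gridIndex k w ∈ S k) →
      ∃ k ≥ K, ((2 : ℝ) ^ s') ^ k < (S k).card := by
  classical
  have h2 : (0 : ℝ) < 2 ^ s := by positivity
  -- With at most `(2 ^ s') ^ k` squares at level `k`, the cost of that level would be at most the
  -- `k`th power of this ratio.
  obtain ⟨K₀, hK₀⟩ := exists_not_covered hs hA (C := 1) (q := 2 ^ s' / 2 ^ s) zero_le_one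
    (by positivity) ((div_lt_one h2).2 (Real.rpow_lt_rpow_of_exponent_lt (by norm_num) hs'))
  refine ⟨K₀, fun K hK S hS => ?_⟩
  obtain ⟨k, hk, h⟩ := hK₀ K hK (fun k => (S k).image fun z => (k, z)) fun w hw => by
    obtain ⟨k, hk, h⟩ := hS w hw
    exact ⟨k, hk, (k, gridIndex k w), Finset.mem_image_of_mem _ h, rfl⟩
  refine ⟨k, hk, ?_⟩
  rw [Finset.sum_image (fun a _ b _ hab => (Prod.mk.inj hab).2)] at h
  simp only [Finset.sum_const, nsmul_eq_mul] at h
  rw [one_mul, div_pow, div_lt_iff₀ (by positivity), mul_assoc, ← mul_pow,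
    inv_mul_cancel₀ h2.ne', one_pow, mul_one] at h
  exact h

/-- Rounds the diameter of a covering set up to a power of two. The cutoff at `1 / 2 ^ (K + n)`
handles sets of zero or tiny diameter: the `n`th set of a cover is then charged a term of a
geometric series. -/
lemma exists_scale_of_ediam_le {K n : ℕ} {e : ENNReal} (he : e ≤ ENNReal.ofReal (1 / 2 ^ K)) :
    ∃ k ≥ K, e ≤ ENNReal.ofReal (1 / 2 ^ k) ∧
      ENNReal.ofReal (1 / 2 ^ k) ≤ max (2 * e) (ENNReal.ofReal (1 / 2 ^ (K + n))) := by
  have hfin : e ≠ ⊤ := ne_top_of_le_ne_top ENNReal.ofReal_ne_top he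
  obtain ⟨r, hr0, rfl⟩ : ∃ r : ℝ, 0 ≤ r ∧ e = ENNReal.ofReal r :=
    ⟨e.toReal, ENNReal.toReal_nonneg, (ENNReal.ofReal_toReal hfin).symm⟩
  rw [ENNReal.ofReal_le_ofReal_iff (by positivity)] at he
  by_cases hr : r ≤ 1 / 2 ^ (K + n)
  · exact ⟨K + n, Nat.le_add_right _ _, ENNReal.ofReal_le_ofReal hr, le_max_right _ _⟩
  push Not at hr
  have hex : ∃ k, 1 / 2 ^ (k + 1) < r := by
    refine ⟨K + n, lt_of_le_of_lt ?_ hr⟩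
    exact one_div_le_one_div_of_le (by positivity) (pow_le_pow_right₀ (by norm_num) (by omega))
  classical
  have hfind := Nat.find_spec hex
  set k := Nat.find hex with hk
  have hkK : K ≤ k := by
    by_contra hlt
    push Not at hlt
    have h1 : 1 / (2 : ℝ) ^ K ≤ 1 / 2 ^ (k + 1) :=
      one_div_le_one_div_of_le (by positivity) (pow_le_pow_right₀ (by norm_num) (by omega))
    linarith
  refine ⟨k, hkK, ENNReal.ofReal_le_ofReal ?_, le_trans ?_ (le_max_left _ _)⟩
  · rcases eq_or_lt_of_le hkK with h | h
    · rw [← h]; exact he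
    · have := Nat.find_min hex (m := k - 1) (by omega)
      push Not at this
      rwa [Nat.sub_add_cancel (by omega)] at this
  · rw [← ENNReal.ofReal_ofNat 2, ← ENNReal.ofReal_mul (by norm_num)]
    refine ENNReal.ofReal_le_ofReal ?_
    rw [pow_succ, ← div_div] at hfind
    linarith

/-- A set of dimension less than `d` can be covered by small dyadic squares of which at most
`O(2 ^ (k d))` have side `2⁻ᵏ`. -/
lemma exists_grid_cover_of_dimH_lt {A : Set Plane} {d : ℝ} (hd : 0 < d)
    (hA : dimH A < ENNReal.ofReal d) :
    ∃ C : ℝ, 0 < C ∧ ∀ K : ℕ, ∃ S : ℕ → Finset (ℤ × ℤ),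
      (∀ w ∈ A, ∃ k ≥ K, gridIndex k w ∈ S k) ∧ ∀ k, ((S k).card : ℝ) ≤ C * ((2 : ℝ) ^ d) ^ k := by
  classical
  have hμ : MeasureTheory.Measure.hausdorffMeasure d A = 0 := by
    have := hausdorffMeasure_of_dimH_lt (d := d.toNNReal) hA
    rwa [Real.coe_toNNReal _ hd.le] at this
  have h2d : (1 : ℝ) < 2 ^ d := Real.one_lt_rpow (by norm_num) hd
  have h2d0 : (0 : ℝ) < 2 ^ d := by positivity
  set q : ℝ := ((2 : ℝ) ^ d)⁻¹ with hq
  have hq0 : 0 < q := by positivity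
  have hq1 : q < 1 := inv_lt_one_of_one_lt₀ h2d
  have hq1' : 0 < 1 - q := by linarith
  -- The 9 is a 3 × 3 block of squares around a point of each covering set, `2 ^ d` comes from
  -- rounding diameters up, and the geometric series pays for the tiny sets.
  refine ⟨9 * (2 ^ d + (1 - q)⁻¹), by positivity, fun K => ?_⟩
  rw [MeasureTheory.Measure.hausdorffMeasure_apply] at hμ
  have hpos : 0 < ENNReal.ofReal (1 / 2 ^ K) := ENNReal.ofReal_pos.2 (by positivity)
  have hlt : (⨅ (t : ℕ → Set Plane) (_ : A ⊆ ⋃ n, t n)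
      (_ : ∀ n, Metric.ediam (t n) ≤ ENNReal.ofReal (1 / 2 ^ K)),
      ∑' n, ⨆ _ : (t n).Nonempty, Metric.ediam (t n) ^ d) < 1 := by
    refine lt_of_le_of_lt ?_ zero_lt_one
    rw [← hμ]
    exact le_iSup₂ (f := fun (r : ENNReal) (_ : 0 < r) => ⨅ (t : ℕ → Set Plane) (_ : A ⊆ ⋃ n, t n)
      (_ : ∀ n, Metric.ediam (t n) ≤ r), ∑' n, ⨆ _ : (t n).Nonempty, Metric.ediam (t n) ^ d)
      (ENNReal.ofReal (1 / 2 ^ K)) hpos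
  simp only [iInf_lt_iff] at hlt
  obtain ⟨t, ht, hdiam, hsum⟩ := hlt
  have hscale : ∀ n, ∃ k ≥ K, Metric.ediam (t n) ≤ ENNReal.ofReal (1 / 2 ^ k) ∧
      ENNReal.ofReal (1 / 2 ^ k) ≤
        max (2 * Metric.ediam (t n)) (ENNReal.ofReal (1 / 2 ^ (K + n))) :=
    fun n => exists_scale_of_ediam_le (hdiam n)
  choose κ hκK hκ1 hκ2 using hscale
  have hpow : ∀ k : ℕ, ENNReal.ofReal (1 / 2 ^ k) ^ d = ENNReal.ofReal (q ^ k) := by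
    intro k
    rw [ENNReal.ofReal_rpow_of_nonneg (by positivity) hd.le, Real.div_rpow (by norm_num)
      (by positivity), Real.one_rpow, ← Real.rpow_natCast 2 k, ← Real.rpow_mul (by norm_num),
      mul_comm (k : ℝ) d, Real.rpow_mul (by norm_num), Real.rpow_natCast, one_div, hq, inv_pow]
  have hterm : ∀ n, (t n).Nonempty → ENNReal.ofReal (q ^ κ n) ≤
      ENNReal.ofReal (2 ^ d) * (⨆ _ : (t n).Nonempty, Metric.ediam (t n) ^ d) +
        ENNReal.ofReal (q ^ n) := by
    intro n hn
    rw [← hpow, iSup_pos hn]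
    refine (ENNReal.rpow_le_rpow (hκ2 n) hd.le).trans ?_
    rcases max_cases (2 * Metric.ediam (t n)) (ENNReal.ofReal (1 / 2 ^ (K + n))) with h | h
    · have e : (2 : ENNReal) ^ d = ENNReal.ofReal (2 ^ d) := by
        rw [← ENNReal.ofReal_ofNat 2, ENNReal.ofReal_rpow_of_nonneg (by norm_num) hd.le]
      rw [h.1, ENNReal.mul_rpow_of_nonneg _ _ hd.le, e]
      exact le_self_add
    · rw [h.1, hpow]
      refine le_add_left (ENNReal.ofReal_le_ofReal ?_)
      exact pow_le_pow_of_le_one hq0.le hq1.le (Nat.le_add_left _ _)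
  have htotal : ∑' n, (ENNReal.ofReal (2 ^ d) * (⨆ _ : (t n).Nonempty, Metric.ediam (t n) ^ d) +
      ENNReal.ofReal (q ^ n)) ≤ ENNReal.ofReal (2 ^ d + (1 - q)⁻¹) := by
    rw [ENNReal.tsum_add, ENNReal.tsum_mul_left, ENNReal.ofReal_add h2d0.le (by positivity),
      ← ENNReal.ofReal_tsum_of_nonneg (fun n => by positivity)
        (summable_geometric_of_lt_one hq0.le hq1), tsum_geometric_of_lt_one hq0.le hq1]
    gcongr
    calc _ ≤ ENNReal.ofReal (2 ^ d) * 1 := by gcongr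
      _ = _ := mul_one _
  have hJ : ∀ (k : ℕ) (J : Finset ℕ), (∀ n ∈ J, (t n).Nonempty ∧ κ n = k) →
      (J.card : ℝ) ≤ (2 ^ d + (1 - q)⁻¹) * ((2 : ℝ) ^ d) ^ k := by
    intro k J hJ
    have h1 : ∑ _n ∈ J, ENNReal.ofReal (q ^ k) ≤ ENNReal.ofReal (2 ^ d + (1 - q)⁻¹) := by
      refine le_trans (Finset.sum_le_sum fun n hn => ?_) ((ENNReal.sum_le_tsum J).trans htotal)
      rw [← (hJ n hn).2]
      exact hterm n (hJ n hn).1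
    rw [← ENNReal.ofReal_sum_of_nonneg fun _ _ => by positivity,
      ENNReal.ofReal_le_ofReal_iff (by positivity), Finset.sum_const, nsmul_eq_mul, hq, inv_pow,
      ← div_eq_mul_inv, div_le_iff₀ (by positivity)] at h1
    exact h1
  have hfinJ : ∀ k, {n | (t n).Nonempty ∧ κ n = k}.Finite := by
    intro k
    by_contra hinf
    obtain ⟨J, hJsub, hJcard⟩ := Set.Infinite.exists_subset_card_eq hinf
      (⌊(2 ^ d + (1 - q)⁻¹) * ((2 : ℝ) ^ d) ^ k⌋₊ + 1)
    have h1 := hJ k J fun n hn => hJsub hn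
    have h2 := Nat.lt_floor_add_one ((2 ^ d + (1 - q)⁻¹) * ((2 : ℝ) ^ d) ^ k)
    rw [hJcard] at h1
    push_cast at h1
    linarith
  have hpt : ∀ n, (t n).Nonempty → ∃ w, w ∈ t n := fun n hn => hn
  choose! w hw using hpt
  refine ⟨fun k => (hfinJ k).toFinset.biUnion fun n => latticeBlock (gridIndex k (w n)) 1, ?_, ?_⟩
  · intro a ha
    obtain ⟨n, hn⟩ := Set.mem_iUnion.1 (ht ha)
    refine ⟨κ n, hκK n, Finset.mem_biUnion.2 ⟨n, ?_, ?_⟩⟩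
    · rw [Set.Finite.mem_toFinset]
      exact ⟨⟨a, hn⟩, rfl⟩
    · refine gridIndex_mem_latticeBlock ?_
      have h1 := (Metric.edist_le_ediam_of_mem hn (hw n ⟨a, hn⟩)).trans (hκ1 n)
      rw [edist_dist, ENNReal.ofReal_le_ofReal_iff (by positivity)] at h1
      rwa [Nat.cast_one]
  · intro k
    have h1 := hJ k (hfinJ k).toFinset fun n hn => (hfinJ k).mem_toFinset.1 hn
    have h2 := Finset.card_biUnion_le_card_mul (hfinJ k).toFinset
      (fun n => latticeBlock (gridIndex k (w n)) 1) 9 fun n _ => (card_latticeBlock _ _).le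
    have h3 : ((((hfinJ k).toFinset.biUnion fun n =>
        latticeBlock (gridIndex k (w n)) 1).card : ℕ) : ℝ) ≤ (hfinJ k).toFinset.card * 9 := by
      exact_mod_cast h2
    refine h3.trans ?_
    linarith

/-! ### Second moment over a Frostman set -/

/-- Cauchy–Schwarz for the function that counts, at each `z ∈ S`, the sets `A x` containing it. -/
lemma sq_sum_card_le {α β : Type*} [DecidableEq β] (P : Finset α) (S : Finset β)
    (A : α → Finset β) (hA : ∀ x ∈ P, A x ⊆ S) :
    (∑ x ∈ P, ((A x).card : ℝ)) ^ 2 ≤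
      S.card * ∑ x ∈ P, ∑ y ∈ P, ((A x ∩ A y).card : ℝ) := by
  have h1 : ∑ x ∈ P, ((A x).card : ℝ) = ∑ z ∈ S, ∑ x ∈ P, if z ∈ A x then (1 : ℝ) else 0 := by
    rw [Finset.sum_comm]
    refine Finset.sum_congr rfl fun x hx => ?_
    rw [Finset.sum_boole, Finset.filter_mem_eq_inter, Finset.inter_eq_right.2 (hA x hx)]
  have h2 : ∑ x ∈ P, ∑ y ∈ P, ((A x ∩ A y).card : ℝ) =
      ∑ z ∈ S, (∑ x ∈ P, if z ∈ A x then (1 : ℝ) else 0) ^ 2 := by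
    simp only [sq, Finset.sum_mul_sum]
    symm
    rw [Finset.sum_comm]
    refine Finset.sum_congr rfl fun x hx => ?_
    rw [Finset.sum_comm]
    refine Finset.sum_congr rfl fun y _ => ?_
    have e : ∀ z, ((if z ∈ A x then (1 : ℝ) else 0) * if z ∈ A y then (1 : ℝ) else 0) =
        if z ∈ A x ∩ A y then (1 : ℝ) else 0 := by
      intro z
      by_cases hx : z ∈ A x <;> by_cases hy : z ∈ A y <;> simp [hx, hy]
    simp only [e]
    rw [Finset.sum_boole, Finset.filter_mem_eq_inter,
      Finset.inter_eq_right.2 (Finset.inter_subset_left.trans (hA x hx))]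
  rw [h1, h2]
  exact sq_sum_le_card_mul_sum_sq

/-- The alternative `l = m` collects all distances below the finest scale, where only the trivial
bound on the kernel is available. -/
lemma exists_dyadic_annulus {ρ : ℝ} (hρ : ρ ≤ 2) (m : ℕ) :
    ∃ l ≤ m, ρ ≤ 2 / 2 ^ l ∧ (1 / 2 ^ l ≤ ρ ∨ l = m) := by
  induction m with
  | zero => exact ⟨0, le_rfl, by simpa using hρ, Or.inr rfl⟩
  | succ m ih =>
    obtain ⟨l, hl, h1, h2⟩ := ih
    by_cases h : 1 / 2 ^ l ≤ ρ
    · exact ⟨l, by omega, h1, Or.inl h⟩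
    · obtain rfl := h2.resolve_left h
      refine ⟨l + 1, le_rfl, ?_, Or.inr rfl⟩
      push Not at h
      rw [pow_succ', mul_comm, ← div_div, div_right_comm, div_self two_ne_zero]
      exact h.le

/-- Summing a kernel bounded by `B / |x - y|` over a discrete Frostman set of exponent at most
one. -/
lemma sum_le_of_frostman {P : Finset Plane} {m : ℕ} {a M B : ℝ} (ha : 1 ≤ a) (ha2 : a ≤ 2)
    (hfro : ∀ l ≤ m, ∀ z, ((P.filter fun p => gridIndex l p = z).card : ℝ) ≤ a ^ (m - l))
    {x : Plane} (hx : ∀ y ∈ P, dist y x ≤ 2) (g : Plane → ℝ) (hM : 0 ≤ M) (hB : 0 ≤ B)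
    (hgM : ∀ y ∈ P, g y ≤ M) (hgB : ∀ y ∈ P, g y * dist y x ≤ B) :
    ∑ y ∈ P, g y ≤ 25 * (M + (m + 1) * B * 2 ^ m) := by
  classical
  -- A ball of radius `2 / 2 ^ l` meets at most 25 squares of side 2⁻ˡ.
  have hball : ∀ l ≤ m, ((P.filter fun y => dist y x ≤ 2 / 2 ^ l).card : ℝ) ≤
      25 * a ^ (m - l) := by
    intro l hl
    refine card_le_mul_of_fibers _ (gridIndex l) (by positivity) ?_ ?_
    · intro z
      refine le_trans (Nat.cast_le.2 (Finset.card_le_card ?_)) (hfro l hl z)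
      exact Finset.filter_subset_filter _ (Finset.filter_subset _ _)
    · have hsub : (P.filter fun y => dist y x ≤ 2 / 2 ^ l).image (gridIndex l) ⊆
          latticeBlock (gridIndex l x) 2 := by
        intro z hz
        obtain ⟨y, hy, rfl⟩ := Finset.mem_image.1 hz
        exact gridIndex_mem_latticeBlock (by exact_mod_cast (Finset.mem_filter.1 hy).2)
      have := Finset.card_le_card hsub
      rw [card_latticeBlock] at this
      exact_mod_cast this
  have hpt : ∀ y ∈ P, g y ≤ (if dist y x ≤ 2 / 2 ^ m then M else 0) +
      ∑ l ∈ Finset.range (m + 1), if dist y x ≤ 2 / 2 ^ l then B * 2 ^ l else 0 := by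
    intro y hy
    have hnn : ∀ l ∈ Finset.range (m + 1),
        0 ≤ if dist y x ≤ 2 / 2 ^ l then B * 2 ^ l else 0 := by
      intro l _
      split_ifs <;> positivity
    obtain ⟨l, hl, h1, h2⟩ := exists_dyadic_annulus (hx y hy) m
    rcases h2 with h2 | rfl
    · have h3 : g y ≤ B * 2 ^ l := by
        rcases le_or_gt (g y) 0 with hg | hg
        · exact hg.trans (by positivity)
        · have h4 := (mul_le_mul_of_nonneg_left h2 hg.le).trans (hgB y hy)
          rwa [mul_one_div, div_le_iff₀ (by positivity)] at h4
      have h4 := Finset.single_le_sum hnn (Finset.mem_range.2 (Nat.lt_succ_of_le hl))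
      rw [if_pos h1] at h4
      have h5 : 0 ≤ if dist y x ≤ 2 / 2 ^ m then M else 0 := by split_ifs <;> [exact hM; rfl]
      linarith
    · rw [if_pos h1]
      have := Finset.sum_nonneg hnn
      linarith [hgM y hy]
  refine (Finset.sum_le_sum hpt).trans ?_
  rw [Finset.sum_add_distrib, Finset.sum_comm]
  have hind : ∀ (l : ℕ) (b : ℝ), ∑ y ∈ P, (if dist y x ≤ 2 / 2 ^ l then b else 0) =
      (P.filter fun y => dist y x ≤ 2 / 2 ^ l).card * b := by
    intro l b
    rw [← Finset.sum_filter, Finset.sum_const, nsmul_eq_mul]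
  simp only [hind]
  have hnear := hball m le_rfl
  rw [Nat.sub_self, pow_zero, mul_one] at hnear
  have h1 := mul_le_mul_of_nonneg_right hnear hM
  have h2 : ∑ l ∈ Finset.range (m + 1),
      ((P.filter fun y => dist y x ≤ 2 / 2 ^ l).card : ℝ) * (B * 2 ^ l) ≤
      ∑ _l ∈ Finset.range (m + 1), 25 * (B * 2 ^ m) := by
    refine Finset.sum_le_sum fun l hl => ?_
    have hl' : l ≤ m := Nat.lt_succ_iff.1 (Finset.mem_range.1 hl)
    refine (mul_le_mul_of_nonneg_right (hball l hl') (by positivity)).trans ?_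
    -- Exponent at most one enters here: every annulus contributes no more than the bound `25 * (B *
    -- 2 ^ m)` for the finest scale.
    have h3 : a ^ (m - l) ≤ 2 ^ (m - l) := pow_le_pow_left₀ (by linarith) ha2 _
    have h4 : (2 : ℝ) ^ m = 2 ^ (m - l) * 2 ^ l := by rw [← pow_add, Nat.sub_add_cancel hl']
    have h5 : 0 ≤ B * 2 ^ l := by positivity
    calc 25 * a ^ (m - l) * (B * 2 ^ l) ≤ 25 * 2 ^ (m - l) * (B * 2 ^ l) := by gcongr
      _ = 25 * (B * 2 ^ m) := by rw [h4]; ring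
  rw [Finset.sum_const, Finset.card_range, nsmul_eq_mul] at h2
  push_cast at h2
  linarith

/-- If from each point of a discrete Frostman set `P` at least `M` squares of a family `S` of
dyadic squares of side `2⁻ᵏ` are seen to meet `Γ`, then `S` is large. -/
lemma card_mul_sq_le {Γ : Set Plane} (hΓ : IsPreconnected Γ) {R : ℝ} (hR : 2 ≤ R) (k r m : ℕ)
    (hr : R ≤ 2 ^ r) {P : Finset Plane} {a : ℝ} (ha : 1 ≤ a) (ha2 : a ≤ 2)
    (hfro : ∀ l ≤ m, ∀ z, ((P.filter fun p => gridIndex l p = z).card : ℝ) ≤ a ^ (m - l))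
    {z₀ : ℤ × ℤ} (hP : ∀ p ∈ P, gridIndex 0 p = z₀) (hΓR : ∀ p ∈ P, ∀ w ∈ Γ, dist w p ≤ R)
    (S : Finset (ℤ × ℤ)) (M : ℕ)
    (hM : ∀ p ∈ P, ∃ A ⊆ S, A.card = M ∧ ∀ z ∈ A, ∃ u ∈ visiblePart Γ p, gridIndex k u = z) :
    (P.card : ℝ) * M ^ 2 ≤
      S.card * (25 * (M + (m + 1) * (4000000 * R ^ 2 * (k + r + 2) ^ 2 * 2 ^ k) * 2 ^ m)) := by
  classical
  rcases P.eq_empty_or_nonempty with rfl | hne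
  · simp only [Finset.card_empty, Nat.cast_zero, zero_mul]
    positivity
  have hcard : (0 : ℝ) < P.card := by exact_mod_cast hne.card_pos
  choose! A hAS hAM hAv using hM
  have hdist : ∀ p ∈ P, ∀ q ∈ P, dist p q ≤ 2 := fun p hp q hq => by
    have := dist_le_of_gridIndex_eq ((hP p hp).trans (hP q hq).symm)
    simpa using this
  have hrow : ∀ x ∈ P, ∑ y ∈ P, ((A x ∩ A y).card : ℝ) ≤
      25 * (M + (m + 1) * (4000000 * R ^ 2 * (k + r + 2) ^ 2 * 2 ^ k) * 2 ^ m) := by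
    intro x hx
    refine sum_le_of_frostman ha ha2 hfro (fun y hy => hdist y hy x hx) _ (by positivity)
      (by positivity) ?_ ?_
    · intro y _
      rw [← hAM x hx]
      exact_mod_cast Finset.card_le_card Finset.inter_subset_left
    · intro y hy
      rcases eq_or_ne x y with rfl | hxy
      · rw [dist_self, mul_zero]
        positivity
      · have h := card_common_le hΓ hxy (by linarith) ((hdist x hx y hy).trans hR) k r hr
          (hΓR x hx) (hΓR y hy) (A x ∩ A y)
          (fun z hz => hAv x hx z (Finset.mem_inter.1 hz).1)
          (fun z hz => hAv y hy z (Finset.mem_inter.1 hz).2)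
        rwa [le_div_iff₀ (dist_pos.2 hxy), dist_comm] at h
  have hcs := sq_sum_card_le P S A hAS
  have hsum : ∑ x ∈ P, ((A x).card : ℝ) = P.card * M := by
    rw [Finset.sum_congr rfl fun x hx => by rw [hAM x hx], Finset.sum_const, nsmul_eq_mul]
  have htot := Finset.sum_le_sum hrow
  rw [Finset.sum_const, nsmul_eq_mul] at htot
  rw [hsum] at hcs
  have h := hcs.trans (mul_le_mul_of_nonneg_left htot (Nat.cast_nonneg _))
  refine le_of_mul_le_mul_left ?_ hcard
  linarith

/-- Absorbs the logarithmic losses: two powers of `k` from the count of common squares and one from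
the number of annuli. -/
lemma exists_forall_mul_cube_lt_pow (C : ℝ) (c : ℕ) {b : ℝ} (hb : 1 < b) :
    ∃ K : ℕ, ∀ k ≥ K, C * ((k : ℝ) + c) ^ 3 < b ^ k := by
  have h := ((tendsto_pow_const_div_const_pow_of_one_lt 3 hb).comp
    (Filter.tendsto_add_atTop_nat c)).const_mul (C * b ^ c)
  rw [mul_zero] at h
  obtain ⟨K, hK⟩ := Filter.eventually_atTop.1 (h.eventually_lt_const one_pos)
  refine ⟨K, fun k hk => ?_⟩
  have h1 := hK k hk
  have hb0 : 0 < b := by linarith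
  have e : C * b ^ c * ((((k + c : ℕ) : ℝ)) ^ 3 / b ^ (k + c)) =
      C * ((k : ℝ) + c) ^ 3 / b ^ k := by
    rw [pow_add]
    push_cast
    field_simp
  simp only [Function.comp_apply] at h1
  rw [e, div_lt_one (by positivity)] at h1
  exact h1

/-! ### Exponents and the dimension bound -/

/-- The numerical contradiction behind the dimension estimate. -/
lemma exists_scale_contradiction {d s t ε C R : ℝ} (hs1 : 1 < s) (hs2 : s ≤ 2) (hε : 0 < ε)
    (hεt : ε < t) (ht1 : t ≤ 1) (hslack : ε * (s + 3) ≤ t * (s - 1) + s - d) (hC : 0 < C)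
    (r : ℕ) :
    ∃ K : ℕ, ∀ k ≥ K, ∀ N S : ℝ, ∀ M : ℕ, 0 ≤ S → ((2 : ℝ) ^ (t - ε)) ^ ⌊k * (s - 1)⌋₊ ≤ N →
      S ≤ C * ((2 : ℝ) ^ (d + ε)) ^ k → ((2 : ℝ) ^ (s - ε)) ^ k ≤ M →
      (M : ℝ) ≤ 2 * ((2 : ℝ) ^ (s - ε)) ^ k →
      S * (25 * (M + (⌊k * (s - 1)⌋₊ + 1) * (4000000 * R ^ 2 * (k + r + 2) ^ 2 * 2 ^ k) *
        2 ^ ⌊k * (s - 1)⌋₊)) < N * (M : ℝ) ^ 2 := by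
  obtain ⟨K, hK⟩ := exists_forall_mul_cube_lt_pow (2 * C * 25 * (2 + 4000000 * R ^ 2)) (r + 2)
    (b := 2 ^ ε) (Real.one_lt_rpow (by norm_num) hε)
  refine ⟨K, fun k hk N S M hS0 hN hS hM1 hM2 => ?_⟩
  have hkK := hK k hk
  set m := ⌊k * (s - 1)⌋₊ with hm
  have hmle : (m : ℝ) ≤ k * (s - 1) :=
    Nat.floor_le (mul_nonneg (Nat.cast_nonneg k) (by linarith))
  have hmlt : k * (s - 1) < (m : ℝ) + 1 := Nat.lt_floor_add_one _
  have hk0 : (0 : ℝ) ≤ k := Nat.cast_nonneg k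
  have two : (0 : ℝ) < 2 := by norm_num
  have hpow : ∀ (e : ℝ) (n : ℕ), ((2 : ℝ) ^ e) ^ n = 2 ^ (e * n) := fun e n =>
    (Real.rpow_mul_natCast two.le e n).symm
  rw [hpow] at hN hS hM1 hM2 hkK
  have hmono : ∀ {e f : ℝ}, e ≤ f → (2 : ℝ) ^ e ≤ 2 ^ f := fun h =>
    Real.rpow_le_rpow_of_exponent_le (by norm_num) h
  set X : ℝ := (k : ℝ) + r + 2 with hX
  have hX1 : 1 ≤ X := by
    have : (0 : ℝ) ≤ r := Nat.cast_nonneg r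
    linarith
  have hmk : (m : ℝ) + 1 ≤ X := by
    have : (0 : ℝ) ≤ r := Nat.cast_nonneg r
    nlinarith
  have h2m : (2 : ℝ) ^ k * 2 ^ m ≤ 2 ^ (s * k) := by
    rw [← Real.rpow_natCast 2 k, ← Real.rpow_natCast 2 m, ← Real.rpow_add two]
    exact hmono (by linarith)
  have hM3 : (M : ℝ) ≤ 2 * 2 ^ (s * k) := by
    refine hM2.trans (mul_le_mul_of_nonneg_left (hmono ?_) two.le)
    nlinarith
  have hpos : (0 : ℝ) < 2 ^ (s * k) := by positivity
  have hbr : (M : ℝ) + (m + 1) * (4000000 * R ^ 2 * X ^ 2 * 2 ^ k) * 2 ^ m ≤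
      (2 + 4000000 * R ^ 2) * X ^ 3 * 2 ^ (s * k) := by
    have h1 : (M : ℝ) ≤ 2 * X ^ 3 * 2 ^ (s * k) := by
      have : 1 ≤ X ^ 3 := one_le_pow₀ hX1
      nlinarith
    have h2 : (m + 1) * (4000000 * R ^ 2 * X ^ 2 * 2 ^ k) * 2 ^ m ≤
        4000000 * R ^ 2 * X ^ 3 * 2 ^ (s * k) := by
      calc (m + 1) * (4000000 * R ^ 2 * X ^ 2 * 2 ^ k) * 2 ^ m
          = (m + 1) * (4000000 * R ^ 2 * X ^ 2) * (2 ^ k * 2 ^ m) := by ring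
        _ ≤ X * (4000000 * R ^ 2 * X ^ 2) * 2 ^ (s * k) := by gcongr
        _ = 4000000 * R ^ 2 * X ^ 3 * 2 ^ (s * k) := by ring
    linarith
  -- Per unit of `k`, the exponent `(t - ε) * (s - 1) + 2 * (s - ε)` must exceed `(d + ε) + s` by
  -- `ε`, which is `hslack`. Rounding in `m` loses a factor of at most 2, as `t - ε ≤ 1`; hence the
  -- division by 2.
  have hNM : (2 : ℝ) ^ (ε * k) * (2 ^ ((d + ε) * k) * 2 ^ (s * k)) / 2 ≤ N * (M : ℝ) ^ 2 := by
    have h1 : ((2 : ℝ) ^ ((s - ε) * k)) ^ 2 ≤ (M : ℝ) ^ 2 :=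
      pow_le_pow_left₀ (by positivity) hM1 2
    have h2 : (2 : ℝ) ^ ((t - ε) * m) * (2 ^ ((s - ε) * k)) ^ 2 ≤ N * (M : ℝ) ^ 2 :=
      mul_le_mul hN h1 (by positivity) ((by positivity : (0 : ℝ) ≤ _).trans hN)
    refine le_trans ?_ h2
    rw [sq, ← Real.rpow_add two, ← Real.rpow_add two, ← Real.rpow_add two, ← Real.rpow_add two,
      div_eq_mul_inv, ← Real.rpow_neg_one 2, ← Real.rpow_add two]
    refine hmono ?_
    have h3 : (t - ε) * (k * (s - 1) - 1) ≤ (t - ε) * m :=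
      mul_le_mul_of_nonneg_left (by linarith) (by linarith)
    have h4 := mul_le_mul_of_nonneg_right hslack hk0
    nlinarith
  refine lt_of_lt_of_le ?_ hNM
  have hXr : ((k : ℝ) + ((r + 2 : ℕ) : ℝ)) = X := by rw [hX]; push_cast; ring
  rw [hXr] at hkK
  have hD : (0 : ℝ) < 2 ^ ((d + ε) * k) := by positivity
  calc S * (25 * (M + (m + 1) * (4000000 * R ^ 2 * X ^ 2 * 2 ^ k) * 2 ^ m))
      ≤ C * 2 ^ ((d + ε) * k) * (25 * ((2 + 4000000 * R ^ 2) * X ^ 3 * 2 ^ (s * k))) := by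
        gcongr
    _ = (2 * C * 25 * (2 + 4000000 * R ^ 2) * X ^ 3) *
        (2 ^ ((d + ε) * k) * 2 ^ (s * k)) / 2 := by ring
    _ < 2 ^ (ε * k) * (2 ^ ((d + ε) * k) * 2 ^ (s * k)) / 2 := by gcongr

/-- A set of positive `t`-dimensional Hausdorff measure cannot consist of points from which at every
small scale `Γ` has a visible part as large as a set of dimension `s`, if `t (s - 1) > d - s`. -/
lemma hausdorffMeasure_eq_zero_of_visible_large {Γ : Set Plane} (hΓ : IsPreconnected Γ)
    (hbdd : Bornology.IsBounded Γ) {d s t ε : ℝ} (hd : dimH Γ < ENNReal.ofReal (d + ε))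
    (hdε : 0 < d + ε)
    (hs1 : 1 < s) (hs2 : s ≤ 2) (hε : 0 < ε) (hεt : ε < t) (ht1 : t ≤ 1)
    (hslack : ε * (s + 3) ≤ t * (s - 1) + s - d) {F : Set Plane} {z₀ : ℤ × ℤ}
    (hF : ∀ x ∈ F, gridIndex 0 x = z₀) {K₀ : ℕ}
    (hlarge : ∀ x ∈ F, ∀ K ≥ K₀, ∀ S : ℕ → Finset (ℤ × ℤ),
      (∀ w ∈ visiblePart Γ x, ∃ k ≥ K, gridIndex k w ∈ S k) →
      ∃ k ≥ K, ((2 : ℝ) ^ (s - ε)) ^ k < (S k).card) :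
    MeasureTheory.Measure.hausdorffMeasure t F = 0 := by
  classical
  by_contra hpos
  have hFne : F.Nonempty := by
    by_contra hem
    rw [Set.not_nonempty_iff_eq_empty] at hem
    rw [hem] at hpos
    exact hpos MeasureTheory.measure_empty
  obtain ⟨x₀, hx₀⟩ := hFne
  obtain ⟨R₀, hR₀⟩ := hbdd.subset_closedBall x₀
  set R := max R₀ 0 + 2 with hRdef
  have hR2 : 2 ≤ R := by
    have := le_max_right R₀ 0
    linarith
  have hΓR : ∀ p ∈ F, ∀ w ∈ Γ, dist w p ≤ R := by
    intro p hp w hw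
    have h1 : dist w x₀ ≤ R₀ := hR₀ hw
    have h2 := dist_le_of_gridIndex_eq ((hF x₀ hx₀).trans (hF p hp).symm)
    rw [pow_zero, div_one] at h2
    have h3 := dist_triangle w x₀ p
    have h4 := le_max_left R₀ 0
    linarith
  obtain ⟨r, hr⟩ := pow_unbounded_of_one_lt R (by norm_num : (1 : ℝ) < 2)
  obtain ⟨C, hC, hcover⟩ := exists_grid_cover_of_dimH_lt hdε hd
  obtain ⟨K₁, hK₁⟩ := exists_scale_contradiction (R := R) hs1 hs2 hε hεt ht1 hslack hC r
  have ht0 : 0 < t := hε.trans hεt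
  have two : (0 : ℝ) < 2 := by norm_num
  set a : ℝ := 2 ^ t with hadef
  have ha1 : 1 ≤ a := Real.one_le_rpow (by norm_num) ht0.le
  have ha2 : a ≤ 2 := by
    have := Real.rpow_le_rpow_of_exponent_le (by norm_num : (1 : ℝ) ≤ 2) ht1
    rwa [Real.rpow_one] at this
  have ha0 : 0 < a := by linarith
  -- The factor 2 matches the Frostman cost bound and `2 ^ ε` pays for the floor in `m`, so a family
  -- violating this bound comes with at least `(2 ^ (t - ε)) ^ m` points.
  obtain ⟨K₂, hK₂⟩ := exists_not_covered ht0 hpos (C := 2 * 2 ^ ε) (q := 2 ^ (-(ε * (s - 1))))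
    (by positivity) (by positivity)
    (Real.rpow_lt_one_of_one_lt_of_neg (by norm_num) (neg_neg_of_pos (by
      have : 0 < s - 1 := by linarith
      positivity)))
  set K := max K₀ (max K₁ K₂) with hKdef
  obtain ⟨S, hScov, hScard⟩ := hcover K
  set V : ℕ → Plane → Finset (ℤ × ℤ) := fun k x =>
    (S k).filter fun z => ∃ u ∈ visiblePart Γ x, gridIndex k u = z with hV
  have hfrost : ∀ k : ℕ, ∃ (P : Finset Plane) (T : Finset (ℕ × (ℤ × ℤ))),
      (∀ p ∈ P, p ∈ F ∧ ((2 : ℝ) ^ (s - ε)) ^ k < (V k p).card) ∧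
      (∀ w ∈ F, ((2 : ℝ) ^ (s - ε)) ^ k < (V k w).card → ∃ τ ∈ T, gridIndex τ.1 w = τ.2) ∧
      (∀ l ≤ ⌊k * (s - 1)⌋₊, ∀ z',
        ((P.filter fun p => gridIndex l p = z').card : ℝ) ≤ a ^ (⌊k * (s - 1)⌋₊ - l)) ∧
      ∑ τ ∈ T, a⁻¹ ^ τ.1 ≤ 2 * a⁻¹ ^ ⌊k * (s - 1)⌋₊ * P.card := by
    intro k
    -- The depth is about `k * (s - 1)`, so that `2 ^ k * 2 ^ m` balances the number of visible
    -- squares, about `2 ^ (s * k)`.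
    obtain ⟨P, T, h1, h2, h3, h4, h5⟩ := exists_discrete_frostman
      {x | x ∈ F ∧ ((2 : ℝ) ^ (s - ε)) ^ k < (V k x).card} ha1 ⌊k * (s - 1)⌋₊ _ le_rfl z₀
    rw [Nat.sub_self] at h2 h3 h4
    exact ⟨P, T, h1, fun w hw hwV => h3 w ⟨hw, hwV⟩ (hF w hw), fun l hl => h4 l (Nat.zero_le _) hl,
      h5⟩
  choose P T hPF hTcov hfro hcost using hfrost
  -- Each point of `F` sees many squares of the cover of `Γ` at some level `k ≥ K`. Hence the
  -- families `T k` together cover `F`, and one of them is expensive.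
  obtain ⟨k, hk, hbig⟩ := hK₂ K ((le_max_right _ _).trans (le_max_right _ _)) T fun w hw => by
    obtain ⟨k, hk, h⟩ := hlarge w hw K (le_max_left _ _) (fun k => V k w) fun u hu => by
      obtain ⟨k, hk, h⟩ := hScov u hu.1
      exact ⟨k, hk, Finset.mem_filter.2 ⟨h, u, hu, rfl⟩⟩
    exact ⟨k, hk, hTcov k w hw h⟩
  set m := ⌊k * (s - 1)⌋₊ with hm
  have hN : ((2 : ℝ) ^ (t - ε)) ^ m ≤ (P k).card := by
    have h1 := hbig.trans_le (hcost k)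
    have hmlt : k * (s - 1) < (m : ℝ) + 1 := Nat.lt_floor_add_one _
    have h2 : (2 : ℝ) ^ (-(ε * m)) ≤ 2 ^ ε * ((2 : ℝ) ^ (-(ε * (s - 1)))) ^ k := by
      rw [← Real.rpow_mul_natCast two.le, ← Real.rpow_add two]
      refine Real.rpow_le_rpow_of_exponent_le (by norm_num) ?_
      nlinarith
    have h3 : a⁻¹ ^ m = 2 ^ (-(t * m)) := by
      rw [hadef, inv_pow, ← Real.rpow_mul_natCast two.le, Real.rpow_neg two.le]
    rw [h3] at h1
    have h4 : (2 : ℝ) ^ (-(ε * m)) < 2 ^ (-(t * m)) * (P k).card := by linarith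
    have h5 : ((2 : ℝ) ^ (t - ε)) ^ m = 2 ^ (-(ε * m)) * 2 ^ (t * m) := by
      rw [← Real.rpow_mul_natCast two.le, ← Real.rpow_add two]
      congr 1
      ring
    rw [h5]
    have h6 : (0 : ℝ) < 2 ^ (t * m) := by positivity
    refine (mul_le_mul_of_nonneg_right h4.le h6.le).trans (le_of_eq ?_)
    rw [mul_right_comm, ← Real.rpow_add two, neg_add_cancel, Real.rpow_zero, one_mul]
  have hS1 : (1 : ℝ) ≤ ((2 : ℝ) ^ (s - ε)) ^ k :=
    one_le_pow₀ (Real.one_le_rpow (by norm_num) (by linarith))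
  set M := ⌊((2 : ℝ) ^ (s - ε)) ^ k⌋₊ + 1 with hMdef
  have hM1 : ((2 : ℝ) ^ (s - ε)) ^ k ≤ M := by
    rw [hMdef]
    push_cast
    exact (Nat.lt_floor_add_one _).le
  have hM2 : (M : ℝ) ≤ 2 * ((2 : ℝ) ^ (s - ε)) ^ k := by
    rw [hMdef]
    push_cast
    have := Nat.floor_le (zero_le_one.trans hS1)
    linarith
  have hfinal := card_mul_sq_le hΓ hR2 k r m hr.le ha1 ha2 (hfro k)
    (fun p hp => hF p (hPF k p hp).1) (fun p hp => hΓR p (hPF k p hp).1) (S k) M fun p hp => by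
      obtain ⟨A, hA, hAM⟩ := Finset.exists_subset_card_eq (s := V k p) (n := M)
        ((Nat.floor_lt (by positivity)).2 (hPF k p hp).2)
      exact ⟨A, hA.trans (Finset.filter_subset _ _), hAM,
        fun z hz => (Finset.mem_filter.1 (hA hz)).2⟩
  have hcontra := hK₁ k (((le_max_left _ _).trans (le_max_right _ _)).trans hk) (P k).card
    (S k).card M (Nat.cast_nonneg _) hN (hScard k) hM1 hM2
  exact hcontra.not_ge hfinal

theorem theorem2 (Γ : Set (EuclideanSpace ℝ (Fin 2))) (hcompact : IsCompact Γ)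
    (hconn : IsConnected Γ) (hdim : 1 < dimH Γ) (s : ℝ)
    (hs : 1 / 2 + Real.sqrt ((dimH Γ).toReal - 3 / 4) < s) (hs' : s ≤ (dimH Γ).toReal) :
    dimH {x : EuclideanSpace ℝ (Fin 2) | ENNReal.ofReal s < dimH (visiblePart Γ x)} ≤
      ENNReal.ofReal (((dimH Γ).toReal - s) / (s - 1)) := by
  have htop : dimH Γ ≠ ⊤ := Real.dimH_ne_top Γ
  set d := (dimH Γ).toReal with hd
  have hdΓ : dimH Γ = ENNReal.ofReal d := (ENNReal.ofReal_toReal htop).symm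
  have hd1 : 1 < d := by
    rw [hdΓ, ← ENNReal.ofReal_one, ENNReal.ofReal_lt_ofReal_iff_of_nonneg zero_le_one] at hdim
    exact hdim
  have hd2 : d ≤ 2 := by
    have h1 : dimH Γ ≤ ENNReal.ofReal 2 := by
      refine (dimH_mono (Set.subset_univ Γ)).trans (le_of_eq ?_)
      rw [Real.dimH_univ_eq_finrank, finrank_euclideanSpace_fin]
      norm_num
    rwa [hdΓ, ENNReal.ofReal_le_ofReal_iff (by norm_num)] at h1
  have hsqrt : d - 3 / 4 < (s - 1 / 2) ^ 2 ∧ 1 < s := by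
    have h1 := Real.sqrt_nonneg (d - 3 / 4)
    have h2 := Real.sq_sqrt (by linarith : 0 ≤ d - 3 / 4)
    have h3 : 1 / 2 < Real.sqrt (d - 3 / 4) := Real.lt_sqrt_of_sq_lt (by linarith)
    constructor <;> nlinarith
  obtain ⟨hsq, hs1⟩ := hsqrt
  have hs0 : 0 < s - 1 := by linarith
  -- `hsq` says `d - s < (s - 1) ^ 2`, and the right side is at most `s - 1` because `s ≤ d ≤ 2`.
  have hbound : (d - s) / (s - 1) < 1 := by
    rw [div_lt_one hs0]
    nlinarith
  have hbound0 : 0 ≤ (d - s) / (s - 1) := div_nonneg (by linarith) hs0.le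
  by_contra hcon
  push Not at hcon
  have hcon' : ENNReal.ofReal ((d - s) / (s - 1)) <
      min (dimH {x : Plane | ENNReal.ofReal s < dimH (visiblePart Γ x)}) 1 := by
    refine lt_min hcon ?_
    rw [← ENNReal.ofReal_one]
    exact (ENNReal.ofReal_lt_ofReal_iff one_pos).2 hbound
  obtain ⟨t, ht1, ht2⟩ := ENNReal.lt_iff_exists_nnreal_btwn.1 hcon'
  have htE := ht2.trans_le (min_le_left _ _)
  have ht_one : (t : ℝ) ≤ 1 := by exact_mod_cast (ht2.trans_le (min_le_right _ _)).le
  have ht_gt : (d - s) / (s - 1) < t := by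
    rw [← ENNReal.ofReal_coe_nnreal] at ht1
    exact (ENNReal.ofReal_lt_ofReal_iff_of_nonneg hbound0).1 ht1
  have ht0 : (0 : ℝ) < t := hbound0.trans_lt ht_gt
  have hgap : 0 < t * (s - 1) + s - d := by
    rw [div_lt_iff₀ hs0] at ht_gt
    linarith
  obtain ⟨ε, hε, hεt, hslack⟩ : ∃ ε : ℝ, 0 < ε ∧ ε < t ∧ ε * (s + 3) ≤ t * (s - 1) + s - d := by
    have hs3 : 0 < s + 3 := by linarith
    refine ⟨min (t / 2) ((t * (s - 1) + s - d) / (s + 3)), by positivity,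
      (min_le_left _ _).trans_lt (by linarith), ?_⟩
    rw [← le_div_iff₀ hs3]
    exact min_le_right _ _
  -- Countably many pieces, each with a uniform starting scale and inside one unit square; by
  -- countable stability of dimension, one of them has dimension greater than `t`.
  set E : ℕ × (ℤ × ℤ) → Set Plane := fun i => {x | gridIndex 0 x = i.2 ∧
    ∀ K ≥ i.1, ∀ S : ℕ → Finset (ℤ × ℤ),
      (∀ w ∈ visiblePart Γ x, ∃ k ≥ K, gridIndex k w ∈ S k) →
      ∃ k ≥ K, ((2 : ℝ) ^ (s - ε)) ^ k < (S k).card} with hE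
  have hcover : {x : Plane | ENNReal.ofReal s < dimH (visiblePart Γ x)} ⊆ ⋃ i, E i := by
    intro x hx
    have hμ : MeasureTheory.Measure.hausdorffMeasure s (visiblePart Γ x) ≠ 0 := by
      have := hausdorffMeasure_of_lt_dimH (d := s.toNNReal) hx
      rw [Real.coe_toNNReal _ (by linarith)] at this
      rw [this]
      exact ENNReal.top_ne_zero
    obtain ⟨K₀, hK₀⟩ := exists_card_grid_cover_ge (by linarith) (by linarith : s - ε < s) hμ
    exact Set.mem_iUnion.2 ⟨(K₀, gridIndex 0 x), rfl, hK₀⟩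
  have hlt := htE.trans_le (dimH_mono hcover)
  rw [dimH_iUnion, lt_iSup_iff] at hlt
  obtain ⟨i, hi⟩ := hlt
  have hzero := hausdorffMeasure_eq_zero_of_visible_large hconn.isPreconnected
    hcompact.isBounded (d := d)
    (by rw [hdΓ]; exact (ENNReal.ofReal_lt_ofReal_iff (by linarith)).2 (by linarith))
    (by linarith) hs1 (hs'.trans hd2) hε hεt ht_one hslack (F := E i) (fun x hx => hx.1)
    (fun x hx => hx.2)
  rw [hausdorffMeasure_of_lt_dimH hi] at hzero
  exact ENNReal.top_ne_zero hzero
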